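/- Setting. Let $\mathcal X\subseteq\mathbb R^m$ and $\Omega\subseteq\mathbb R^d$ be convex (Borel) sets. For $\theta\in\Omega$ let $f(\cdot;\theta)$ be a probability density on $\mathcal X$ (Lebesgue measure), with $f$ jointly continuous on $\mathcal X\times\Omega$, and let $g$ be a continuous, strictly positive probability density on $\mathcal X$. For $p\in[0,1)$ put $k_p(x;\theta)=(1-p)f(x;\theta)+p\,g(x)$. Let $\pi_0$ be a prior probability measure on $\Omega$ and $\theta^*\in\Omega$ the true parameter. For a dataset $X=(x_1,\dots,x_n)\in\mathcal X^n$ the posterior under $k_p$ is $$\mathbb P_{\pi_n}(S\mid X)=\frac{\int_S\prod_{i}k_p(x_i;\theta)\,\pi_0(d\theta)}{\int_\Omega\prod_{i}k_p(x_i;\theta)\,\pi_0(d\theta)}.$$ Two datasets of size $n$ are neighbouring if they have all entries but one in common. Let $h^2(q,r)=\frac12\int_{\mathcal X}(\sqrt q-\sqrt r)^2dx$. The bracketing number $N_{[]}(u,\mathcal P)$ is the least number of brackets $[L,U]$, with $L,U\ge0$ integrable and $h(L,U)\le u$, such that each $q\in\mathcal P$ satisfies $L\le q\le U$ on $\mathcal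 X$ for one of them; $H_{[]}=\log N_{[]}\in[0,\infty]$. For $\alpha\in(0,1]$ let $$\rho_{0,\alpha}(\theta^*,\theta)=\frac1\alpha\int_{\mathcal X}\Big[\Big(\frac{f(x;\theta^*)}{f(x;\theta)}\Big)^{\alpha}-1\Big]f(x;\theta^*)\,dx\in[0,\infty],\qquad S_{0,\alpha}(t)=\{\theta\in\Omega:\rho_{0,\alpha}(\theta^*,\theta)\le t\}.$$ Let $\tilde\nabla_\theta f(x;\theta)$ be the supremum, over unit vectors $u$ pointing from $\theta$ into $\Omega$, of the one-sided directional derivatives $\lim_{\xi\downarrow0}\xi^{-1}\big(f(x;\theta+\xi u)-f(x;\theta)\big)$. Theorem. There are universal constants $c,c_1,c_2>0$ with the following property. Let $(\phi_n)_{n\ge1}$ be a decreasing sequence of positive reals, $\alpha\in(0,1]$, $c_3,c_4>0$, $t_n=c_1\phi_n^2/8$, and suppose: 1. $\phi_n\to0$, $n\phi_n^2\to\infty$, and there are $\Omega_1\subseteq\Omega_2\subseteq\cdots$ with union $\Omega$ such that for all $n\ge1$: $\int_{\phi_n^2/2^{10}}^{\phi_n}H_{[]}^{1/2}\big(u,\{f(\cdot;\theta):\theta\in\Omega_n\}\big)\,du\le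 c\sqrt n\,\phi_n^2$. 2. For all $n\ge1$: $\pi_0(S_{0,\alpha}(t_n))\ge c_3e^{-2nt_n}$ and $nt_n>\max\{\tfrac1\alpha,\tfrac{c_1}{8c_2}\}\log n$. 3. For all $n\ge1$: $\pi_0(\Omega\setminus\Omega_n)\le c_4e^{-2c_1n\phi_n^2}$. 4. At each $(x,\theta)\in\mathcal X\times\Omega$ the above directional derivatives of $f(x;\cdot)$ exist and are bounded, and for each fixed $\theta\in\Omega$, $\sup_{x\in\mathcal X}|\tilde\nabla_\theta f(x;\theta)/g(x)|<\infty$. 5. For every $\psi>0$, $\inf_{\theta\in\Omega,\ \|\theta-\theta^*\|_2>\psi}h(f(\cdot;\theta),f(\cdot;\theta^*))>0$. Let $p_0\in(0,1)$. Then there are a sequence $T_n\in(0,\infty)$ and constants $C_1,C_2,C_3\in(0,\infty)$ such that the following holds for every decreasing sequence $(p_n)_{n\ge1}$ in $(0,p_0]$ with $p_n\to0$. (i) There is a sequence $\psi_n\to0$ such that for all large $n$, $$\forall\theta\in\Omega:\quad h(k_{p_n}(\cdot;\theta),k_{p_n}(\cdot;\theta^*))\le\phi_n\ \Longrightarrow\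 \|\theta-\theta^*\|_2\le\psi_n.\qquad(*)$$ (ii) Let $n\ge1$, let $\psi_n$ be any real number satisfying $(*)$, and let $(X,Z)$ be a random pair of neighbouring datasets of size $n$ such that each of $X$, $Z$ has i.i.d. entries with density $k_{p_n}(\cdot;\theta^*)$. Put $$\delta_n=\tfrac4{c_3}e^{-\frac12c_1n\phi_n^2},\quad\tilde\varepsilon_n=\frac{2(1-p_n)T_n\psi_n}{p_n},\quad\epsilon_n=\tilde\varepsilon_n+\log\big(\delta_n+e^{\tilde\varepsilon_n}\big),\quad c_5=\min\{c_1\alpha/8,\,c_2\}.$$ Then, the posteriors being those under $k_{p_n}$, the (outer) probability that $$\forall S\in\mathcal B(\Omega):\quad\mathbb P_{\pi_n}(S\mid X)\le e^{\epsilon_n}\,\mathbb P_{\pi_n}(S\mid Z)+\delta_n$$ fails is at most $C_1e^{-nc_5\phi_n^2}$ if $nc_2\phi_n^2\ge\log2$, and at most $(C_2+C_3(\log\phi_n)^2)e^{-nc_5\phi_n^2}$ otherwise. The same bound, with the same constants, holds when $T_n$ is replaced in $\tilde\varepsilon_n$ by any real $\tau_n$ with $|\tilde\nabla_\theta f(x;\theta)/g(x)|\le\tau_n$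 for all $x\in\mathcal X$ and all $\theta\in\Omega$ with $\|\theta-\theta^*\|_2\le\psi_n$. (iii) Consequently, if $(*)$ holds for all large $n$, then along any such sequence of pairs $(X,Z)$ the privacy inequality of (ii), with $T_n$ or with such $\tau_n$, holds with probability tending to one. -/

import Mathlib

open MeasureTheory Filter Topology Set
open scoped ENNReal

noncomputable section

/-- The statistical model: convex observation and parameter spaces in Euclidean space, a jointly
continuous likelihood `f x θ`, a positive continuous contamination density `g`, a prior
probability on the parameter space and a true parameter. All densities are with respect to
Lebesgue measure on the observation space; values of `f`, `g` off `obs`, `par` play no role. -/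
structure ContaminationModel (m d : ℕ) where
  /-- observation space -/
  obs : Set (EuclideanSpace ℝ (Fin m))
  /-- parameter space -/
  par : Set (EuclideanSpace ℝ (Fin d))
  /-- uncontaminated likelihood -/
  f : EuclideanSpace ℝ (Fin m) → EuclideanSpace ℝ (Fin d) → ℝ
  /-- contamination density -/
  g : EuclideanSpace ℝ (Fin m) → ℝ
  /-- prior distribution -/
  prior : Measure (EuclideanSpace ℝ (Fin d))
  /-- true parameter -/
  θstar : EuclideanSpace ℝ (Fin d)
  convex_obs : Convex ℝ obs
  measurableSet_obs : MeasurableSet obs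
  convex_par : Convex ℝ par
  measurableSet_par : MeasurableSet par
  θstar_mem : θstar ∈ par
  continuousOn_f : ContinuousOn (fun z : EuclideanSpace ℝ (Fin m) × EuclideanSpace ℝ (Fin d) =>
    f z.1 z.2) (obs ×ˢ par)
  f_nonneg : ∀ x ∈ obs, ∀ θ ∈ par, 0 ≤ f x θ
  integral_f : ∀ θ ∈ par, ∫ x in obs, f x θ = 1
  continuousOn_g : ContinuousOn g obs
  g_pos : ∀ x ∈ obs, 0 < g x
  integral_g : ∫ x in obs, g x = 1
  isProbabilityMeasure_prior : IsProbabilityMeasure prior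
  prior_compl : prior parᶜ = 0

/-- Hellinger distance of two nonnegative functions on `X`:
`h² = (1/2) ∫ (√q - √r)²`. -/
def hellinger {m : ℕ} (X : Set (EuclideanSpace ℝ (Fin m)))
    (q r : EuclideanSpace ℝ (Fin m) → ℝ) : ℝ :=
  Real.sqrt ((1 / 2) * ∫ x in X, (Real.sqrt (q x) - Real.sqrt (r x)) ^ 2)

/-- The family `𝒬` of functions on `X` has an `r`-Hellinger bracketing with `N` brackets
`[L j, U j]` made of nonnegative integrable functions. -/
def HasBracketing {m : ℕ} (X : Set (EuclideanSpace ℝ (Fin m))) (r : ℝ)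
    (𝒬 : Set (EuclideanSpace ℝ (Fin m) → ℝ)) (N : ℕ) : Prop :=
  ∃ L U : Fin N → EuclideanSpace ℝ (Fin m) → ℝ,
    (∀ j, IntegrableOn (L j) X ∧ IntegrableOn (U j) X ∧
      (∀ x ∈ X, 0 ≤ L j x) ∧ (∀ x ∈ X, 0 ≤ U j x) ∧ hellinger X (L j) (U j) ≤ r) ∧
    ∀ q ∈ 𝒬, ∃ j, ∀ x ∈ X, L j x ≤ q x ∧ q x ≤ U j x

/-- Hellinger bracketing number (`⊤` if there is no finite bracketing). -/
def bracketingNumber {m : ℕ} (X : Set (EuclideanSpace ℝ (Fin m))) (r : ℝ)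
    (𝒬 : Set (EuclideanSpace ℝ (Fin m) → ℝ)) : ℕ∞ :=
  ⨅ (N : ℕ) (_ : HasBracketing X r 𝒬 N), (N : ℕ∞)

/-- Square root of the Hellinger bracketing entropy, `(log N)^{1/2}`, with value `⊤` if the
bracketing number is infinite. -/
def sqrtBracketingEntropy {m : ℕ} (X : Set (EuclideanSpace ℝ (Fin m))) (r : ℝ)
    (𝒬 : Set (EuclideanSpace ℝ (Fin m) → ℝ)) : ℝ≥0∞ :=
  if bracketingNumber X r 𝒬 = ⊤ then ⊤
  else ENNReal.ofReal (Real.sqrt (Real.log (bracketingNumber X r 𝒬).toNat))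

/-- `x` and `z` are neighbouring datasets: they have all entries but one in common. -/
def Neighbouring {E : Type*} {n : ℕ} (x z : Fin n → E) : Prop :=
  ∃ i, ∀ j, j ≠ i → x j = z j

/-- Unit vectors along which one can leave `θ` without immediately leaving the (convex) set
`A`; these are all unit vectors if `θ` is an interior point. -/
def feasibleDirections {d : ℕ} (A : Set (EuclideanSpace ℝ (Fin d)))
    (θ : EuclideanSpace ℝ (Fin d)) : Set (EuclideanSpace ℝ (Fin d)) :=
  {u | ‖u‖ = 1 ∧ ∃ ξ : ℝ, 0 < ξ ∧ θ + ξ • u ∈ A}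

/-- One-sided directional derivative `lim_{ξ ↓ 0} (φ (θ + ξ u) - φ θ) / ξ`. -/
def dirDeriv {d : ℕ} (φ : EuclideanSpace ℝ (Fin d) → ℝ) (θ u : EuclideanSpace ℝ (Fin d)) : ℝ :=
  derivWithin (fun ξ : ℝ => φ (θ + ξ • u)) (Ici 0) 0

namespace ContaminationModel

variable {m d : ℕ} (M : ContaminationModel m d)

/-- Contaminated likelihood `k_p = (1 - p) f + p g`. -/
def k (p : ℝ) (x : EuclideanSpace ℝ (Fin m)) (θ : EuclideanSpace ℝ (Fin d)) : ℝ :=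
  (1 - p) * M.f x θ + p * M.g x

/-- Hellinger distance between `k_p(·;θ)` and `k_p(·;θ')`; for `p = 0` that between
`f(·;θ)` and `f(·;θ')`. -/
def hell (p : ℝ) (θ θ' : EuclideanSpace ℝ (Fin d)) : ℝ :=
  hellinger M.obs (fun x => M.k p x θ) (fun x => M.k p x θ')

/-- `ρ_{p,α}(θ,ϑ) = (1/α) ∫ [(k_p(x;θ)/k_p(x;ϑ))^α - 1] k_p(x;θ) dx`, possibly `+∞`. As
`k_p(·;θ)` has integral one, the `-1` is taken out of the integral. -/
def rho (p α : ℝ) (θ ϑ : EuclideanSpace ℝ (Fin d)) : EReal :=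
  ((1 / α : ℝ) : EReal) *
    (((∫⁻ x in M.obs, (ENNReal.ofReal (M.k p x θ) / ENNReal.ofReal (M.k p x ϑ)) ^ α *
      ENNReal.ofReal (M.k p x θ) : ℝ≥0∞) : EReal) - 1)

/-- The neighbourhood `S_{p,α}(t)` of the true parameter. -/
def rhoBall (p α t : ℝ) : Set (EuclideanSpace ℝ (Fin d)) :=
  {θ | θ ∈ M.par ∧ M.rho p α M.θstar θ ≤ (t : EReal)}

/-- Supremum of the directional derivatives of `f(x;·)` at `θ`. -/
def supDirDeriv (x : EuclideanSpace ℝ (Fin m)) (θ : EuclideanSpace ℝ (Fin d)) : ℝ :=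
  sSup (dirDeriv (M.f x) θ '' feasibleDirections M.par θ)

/-- Bracketing-entropy assumption for the rates `φ n` and sieves `Om n`, `n ≥ 1`, with
constant `c`. -/
def EntropyAssumption (c : ℝ) (φ : ℕ → ℝ) (Om : ℕ → Set (EuclideanSpace ℝ (Fin d))) : Prop :=
  (∀ n, 1 ≤ n → 0 < φ n) ∧ Tendsto φ atTop (𝓝 0) ∧
  Tendsto (fun n : ℕ => (n : ℝ) * φ n ^ 2) atTop atTop ∧
  (∀ n, 1 ≤ n → Om n ⊆ Om (n + 1)) ∧ (⋃ n ∈ Ici 1, Om n) = M.par ∧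
  ∀ n, 1 ≤ n →
    ∫⁻ u in Ioc (φ n ^ 2 / 2 ^ 10) (φ n),
        sqrtBracketingEntropy M.obs u ((fun θ x => M.f x θ) '' Om n)
      ≤ ENNReal.ofReal (c * Real.sqrt n * φ n ^ 2)

/-- Prior-concentration assumption, with `t n = c₁ (φ n)² / 8`. The growth condition is
multiplied out by `log n`, which vanishes for `n = 1`. -/
def PriorCentreAssumption (c₁ c₂ α c₃ : ℝ) (φ : ℕ → ℝ) : Prop :=
  ∀ n : ℕ, 1 ≤ n →
    ENNReal.ofReal (c₃ * Real.exp (-(2 * n * (c₁ * φ n ^ 2 / 8))))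
      ≤ M.prior (M.rhoBall 0 α (c₁ * φ n ^ 2 / 8)) ∧
    max (1 / α) (c₁ / (8 * c₂)) * Real.log n < n * (c₁ * φ n ^ 2 / 8)

/-- Prior-tail assumption. -/
def PriorTailAssumption (c₁ c₄ : ℝ) (φ : ℕ → ℝ)
    (Om : ℕ → Set (EuclideanSpace ℝ (Fin d))) : Prop :=
  ∀ n : ℕ, 1 ≤ n →
    M.prior (M.par \ Om n) ≤ ENNReal.ofReal (c₄ * Real.exp (-(2 * c₁ * n * φ n ^ 2)))

/-- The directional derivatives of `f(x;·)` exist and are bounded at each point, and for each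
fixed `θ` their supremum is at most a constant times `g`. -/
def TailAssumption : Prop :=
  (∀ x ∈ M.obs, ∀ θ ∈ M.par,
    (∀ u ∈ feasibleDirections M.par θ,
      DifferentiableWithinAt ℝ (fun ξ : ℝ => M.f x (θ + ξ • u)) (Ici 0) 0) ∧
    ∃ B : ℝ, ∀ u ∈ feasibleDirections M.par θ, |dirDeriv (M.f x) θ u| ≤ B) ∧
  ∀ θ ∈ M.par, ∃ B : ℝ, ∀ x ∈ M.obs, |M.supDirDeriv x θ / M.g x| ≤ B

/-- Hellinger identifiability of the uncontaminated model at the true parameter. -/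
def IdentifiabilityAssumption : Prop :=
  ∀ ψ : ℝ, 0 < ψ → ∃ η : ℝ, 0 < η ∧
    ∀ θ ∈ M.par, ψ < ‖θ - M.θstar‖ → η ≤ M.hell 0 θ M.θstar

/-- The Hellinger ball of radius `φ` around the true parameter (in the contaminated model) lies
in the Euclidean ball of radius `ψ`. -/
def RadiusBound (p φ ψ : ℝ) : Prop :=
  ∀ θ ∈ M.par, M.hell p θ M.θstar ≤ φ → ‖θ - M.θstar‖ ≤ ψ

/-- `τ` bounds `|∇̃f / g|` over all observations and all parameters within `ψ` of the true one. -/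
def DerivRatioBound (ψ τ : ℝ) : Prop :=
  ∀ θ ∈ M.par, ‖θ - M.θstar‖ ≤ ψ → ∀ x ∈ M.obs, |M.supDirDeriv x θ / M.g x| ≤ τ

/-- Law of one observation: density `k_p(·;θ*)` on the observation space. -/
def dataLaw (p : ℝ) : Measure (EuclideanSpace ℝ (Fin m)) :=
  (volume.restrict M.obs).withDensity (fun x => ENNReal.ofReal (M.k p x M.θstar))

/-- Joint law of a random pair of neighbouring datasets of size `n`, each of which has
i.i.d. entries with density `k_p(·;θ*)`. -/
def IsNeighbourLaw (p : ℝ) (n : ℕ)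
    (P : Measure ((Fin n → EuclideanSpace ℝ (Fin m)) × (Fin n → EuclideanSpace ℝ (Fin m)))) :
    Prop :=
  P.map Prod.fst = Measure.pi (fun _ => M.dataLaw p) ∧
  P.map Prod.snd = Measure.pi (fun _ => M.dataLaw p) ∧
  ∀ᵐ w ∂P, Neighbouring w.1 w.2

/-- Posterior probability of `S` given the dataset `x`, under the likelihood `k_p`. -/
def posterior (p : ℝ) {n : ℕ} (x : Fin n → EuclideanSpace ℝ (Fin m))
    (S : Set (EuclideanSpace ℝ (Fin d))) : ℝ≥0∞ :=
  (∫⁻ θ in S, ∏ i, ENNReal.ofReal (M.k p (x i) θ) ∂M.prior) /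
    (∫⁻ θ in M.par, ∏ i, ENNReal.ofReal (M.k p (x i) θ) ∂M.prior)

/-- The event that the `(ε, δ)` privacy inequality fails for some measurable `S`. -/
def privacyFailure (p : ℝ) (n : ℕ) (ε δ : ℝ) :
    Set ((Fin n → EuclideanSpace ℝ (Fin m)) × (Fin n → EuclideanSpace ℝ (Fin m))) :=
  {w | ¬ ∀ S : Set (EuclideanSpace ℝ (Fin d)), MeasurableSet S → S ⊆ M.par →
    M.posterior p w.1 S
      ≤ ENNReal.ofReal (Real.exp ε) * M.posterior p w.2 S + ENNReal.ofReal δ}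

end ContaminationModel

/-- `δ_n = (4/c₃) exp(-c₁ n φ² / 2)`. -/
def deltaLevel (c₁ c₃ : ℝ) (n : ℕ) (φ : ℝ) : ℝ :=
  4 / c₃ * Real.exp (-(1 / 2 * c₁ * n * φ ^ 2))

/-- `ε̃_n = 2 (1 - p) T ψ / p`. -/
def epsTilde (p T ψ : ℝ) : ℝ := 2 * (1 - p) * T * ψ / p

/-- `ε_n = ε̃_n + log (δ_n + exp ε̃_n)`. -/
def epsLevel (δ p T ψ : ℝ) : ℝ :=
  epsTilde p T ψ + Real.log (δ + Real.exp (epsTilde p T ψ))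

/-- The bound on the failure probability, with `c₅ = min (c₁ α / 8) c₂`. -/
def failureBound (c₁ c₂ α C₁ C₂ C₃ : ℝ) (n : ℕ) (φ : ℝ) : ℝ :=
  if Real.log 2 ≤ n * c₂ * φ ^ 2 then
    C₁ * Real.exp (-(n * min (c₁ * α / 8) c₂ * φ ^ 2))
  else
    (C₂ + C₃ * Real.log φ ^ 2) * Real.exp (-(n * min (c₁ * α / 8) c₂ * φ ^ 2))

end

/-! Dividing numerator and normalizer of the posterior by the likelihood at the true parameter turns
both into prior integrals of a likelihood ratio whose mean under the data law is at most one. Call a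
dataset good if its normalizer is at least `c₃/2 * exp(-4 n t_n)` and an exceptional set of
parameters contributes at most `2 exp(-n φ²/32)`, which is `δ_n` times that lower bound. Off the
exceptional set every single-observation ratio lies within `exp(±ε̃/2)`. Neighbouring datasets
differ in one entry, so their likelihood ratios differ there by a factor at most `exp ε̃`
(`likRatio_le_of_neighbouring`); comparing numerators and normalizers gives the privacy inequality
(`setLIntegral_div_le`). A union bound over the two marginals handles any dependence within the
pair.

The normalizer is rarely small by two Markov inequalities, one over parameters and one over datasets
(`measure_setLIntegral_likRatio_lt_le`); convexity carries the moment condition from `f` to `k_p`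
(`lintegral_inv_ratio_rpow_le`).

The exceptional set is chosen in two ways. Given a bound `τ` on the derivatives, it consists of the
parameters at Hellinger distance more than `φ_n`. On the sieve, the entropy integral yields a net of
scale `φ/12` with at most `exp(n φ²/32)` points, and each point is tested against the truth with
error `exp(-φ²/16)` per observation; off the sieve the prior mass is small. Within the Hellinger
ball, the radius condition and the derivative bound control the ratio, since `k_p ≥ p g`.

For `T_n` the exceptional set consists of the parameters with `f/g > V` at some observation. These
matter rarely, uniformly in `p`, because `k_p ≤ f + g`; otherwise the ratios are at most `(V+1)/p`.
Every admissible radius is at least the distance to a fixed second parameter of the Hellinger ball,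
so a large enough `T_n` makes `exp(ε̃/2)` exceed `(V+1)/p` for all `p ≤ p₀` at once
(`exists_measure_privacyFailure_le`).

Radii tending to zero come from identifiability through the L¹ distance, which contamination
multiplies by exactly `1 - p` (`hell_zero_sq_le`). -/

/-! ### Integrated likelihood ratios of i.i.d. data. -/

section Abstract

variable {E Θ : Type*} [MeasurableSpace E] [MeasurableSpace Θ]

/-- Likelihood ratio of the dataset `x`, given the likelihood ratio `r` of one observation. -/
noncomputable def likRatio {n : ℕ} (r : E → Θ → ℝ≥0∞) (x : Fin n → E) (θ : Θ) : ℝ≥0∞ :=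
  ∏ j, r (x j) θ

lemma measurable_prodMk_eval {n : ℕ} (j : Fin n) :
    Measurable fun z : (Fin n → E) × Θ => (z.1 j, z.2) :=
  ((measurable_pi_apply j).comp measurable_fst).prodMk measurable_snd

lemma measurable_likRatio {n : ℕ} {r : E → Θ → ℝ≥0∞} (hr : Measurable (Function.uncurry r)) :
    Measurable (Function.uncurry (likRatio (n := n) r)) := by
  have h : ∀ j : Fin n, Measurable fun z : (Fin n → E) × Θ => r (z.1 j) z.2 := fun j =>
    hr.comp (measurable_prodMk_eval j)
  have h' := Finset.measurable_prod Finset.univ fun j (_ : j ∈ Finset.univ) => h j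
  exact h'

lemma lintegral_pi_prod {n : ℕ} (P : Measure E) [IsProbabilityMeasure P]
    (F : Fin n → E → ℝ≥0∞) (hF : ∀ j, Measurable (F j)) :
    ∫⁻ x, ∏ j, F j (x j) ∂(Measure.pi fun _ : Fin n => P) = ∏ j, ∫⁻ y, F j y ∂P := by
  have h := ProbabilityTheory.lintegral_prod_eq_prod_lintegral_of_indepFun
    (μ := Measure.pi fun _ : Fin n => P) Finset.univ (fun j x => F j (x j))
    (ProbabilityTheory.iIndepFun_pi fun i => (hF i).aemeasurable)
    (fun i => (hF i).comp (measurable_pi_apply i))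
  rw [h]
  refine Finset.prod_congr rfl fun j _ => ?_
  exact (measurePreserving_eval (fun _ : Fin n => P) j).lintegral_comp (hF j)

/-- Markov's inequality for an integral over a parameter set. -/
lemma measure_le_setLIntegral_le {Ω : Type*} [MeasurableSpace Ω] (Q : Measure Ω) [SFinite Q]
    (π : Measure Θ) [SFinite π] {A : Set Θ} (hA : MeasurableSet A) {Φ : Ω → Θ → ℝ≥0∞}
    (hΦ : Measurable (Function.uncurry Φ)) {B κ : ℝ≥0∞} (hκ : κ ≠ 0) (hκ' : κ ≠ ∞)
    (hB : ∀ θ ∈ A, ∫⁻ x, Φ x θ ∂Q ≤ B) :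
    Q {x | κ ≤ ∫⁻ θ in A, Φ x θ ∂π} ≤ B * π A / κ := by
  refine (meas_ge_le_lintegral_div ?_ hκ hκ').trans ?_
  · exact (hΦ.lintegral_prod_right' (ν := π.restrict A)).aemeasurable
  · gcongr
    rw [lintegral_lintegral_swap hΦ.aemeasurable]
    calc _ ≤ ∫⁻ _ in A, B ∂π := setLIntegral_mono' hA hB
      _ = B * π A := by simp

variable {n : ℕ} (P : Measure E) [IsProbabilityMeasure P] (π : Measure Θ) [IsFiniteMeasure π]
  {r : E → Θ → ℝ≥0∞}

lemma lintegral_likRatio (hr : Measurable (Function.uncurry r)) (θ : Θ)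
    (h : ∫⁻ y, r y θ ∂P ≤ 1) :
    ∫⁻ x, likRatio (n := n) r x θ ∂(Measure.pi fun _ : Fin n => P) ≤ 1 := by
  unfold likRatio
  rw [lintegral_pi_prod P (fun _ y => r y θ) (fun _ => hr.comp measurable_prodMk_right)]
  exact Finset.prod_le_one' fun _ _ => h

/-- A parameter set of small prior mass rarely gets a large integrated likelihood ratio. -/
lemma measure_le_setLIntegral_likRatio_le (hr : Measurable (Function.uncurry r))
    {A : Set Θ} (hA : MeasurableSet A) (h : ∀ θ ∈ A, ∫⁻ y, r y θ ∂P ≤ 1)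
    {κ : ℝ≥0∞} (hκ : κ ≠ 0) (hκ' : κ ≠ ∞) :
    (Measure.pi fun _ : Fin n => P) {x | κ ≤ ∫⁻ θ in A, likRatio r x θ ∂π} ≤ π A / κ := by
  simpa using measure_le_setLIntegral_le (Measure.pi fun _ : Fin n => P) π hA
    (measurable_likRatio hr) hκ hκ' (fun θ hθ => lintegral_likRatio P hr θ (h θ hθ))

/-- Parameters that can be tested against the true one rarely get a large integrated
likelihood ratio. -/
lemma measure_le_setLIntegral_likRatio_le_of_tests (hr : Measurable (Function.uncurry r))
    {A : Set Θ} (hA : MeasurableSet A) {ι : Type*} (F : Finset ι) (w : ι → E → ℝ≥0∞)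
    (hw : ∀ i, Measurable (w i)) (hw0 : ∀ i x, w i x ≠ 0) {e : ℝ≥0∞}
    (h₁ : ∀ i ∈ F, ∫⁻ y, w i y ∂P ≤ e)
    (h₂ : ∀ θ ∈ A, ∃ i ∈ F, ∫⁻ y, r y θ * (w i y)⁻¹ ∂P ≤ e)
    {κ : ℝ≥0∞} (hκ : κ ≠ 0) (hκ' : κ ≠ ∞) :
    (Measure.pi fun _ : Fin n => P) {x | κ ≤ ∫⁻ θ in A, likRatio r x θ ∂π}
      ≤ F.card * e ^ n + e ^ n * π A / κ := by
  set Q := Measure.pi fun _ : Fin n => P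
  -- Rejection regions: their union has probability at most `F.card * e ^ n`. Off it every product
  -- of weights is below one, so multiplying the likelihood ratio by inverse weights only enlarges
  -- it.
  let R : ι → Set (Fin n → E) := fun i => {x | 1 ≤ ∏ j, w i (x j)}
  have hwm : ∀ i, Measurable fun x : Fin n → E => ∏ j, w i (x j) := fun i =>
    Finset.measurable_prod _ fun j _ => (hw i).comp (measurable_pi_apply j)
  have hR : ∀ i, MeasurableSet (R i) := fun i => measurableSet_le measurable_const (hwm i)
  have hRU : MeasurableSet (⋃ i ∈ F, R i) := F.measurableSet_biUnion fun i _ => hR i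
  let Φ : (Fin n → E) → Θ → ℝ≥0∞ := fun x θ => (⋃ i ∈ F, R i)ᶜ.indicator 1 x * likRatio r x θ
  have hΦ : Measurable (Function.uncurry Φ) :=
    ((measurable_one.indicator hRU.compl).comp measurable_fst).mul (measurable_likRatio hr)
  have hsub : {x | κ ≤ ∫⁻ θ in A, likRatio r x θ ∂π} ⊆
      (⋃ i ∈ F, R i) ∪ {x | κ ≤ ∫⁻ θ in A, Φ x θ ∂π} := by
    intro x hx
    by_cases hxR : x ∈ ⋃ i ∈ F, R i
    · exact Or.inl hxR
    · right
      have : ∀ θ, Φ x θ = likRatio r x θ := fun θ => by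
        simp only [Φ]; rw [indicator_of_mem (by exact hxR)]; simp
      simpa [this] using hx
  refine (measure_mono hsub).trans ((measure_union_le _ _).trans (add_le_add ?_ ?_))
  · refine (measure_biUnion_finset_le _ _).trans ?_
    calc ∑ i ∈ F, Q (R i) ≤ ∑ i ∈ F, e ^ n := by
          refine Finset.sum_le_sum fun i hi => ?_
          refine (meas_ge_le_lintegral_div (hwm i).aemeasurable one_ne_zero
            ENNReal.one_ne_top).trans ?_
          rw [div_one, lintegral_pi_prod P (fun _ => w i) (fun _ => hw i)]
          simpa using pow_le_pow_left' (h₁ i hi) n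
      _ = _ := by simp
  · refine measure_le_setLIntegral_le Q π hA hΦ hκ hκ' fun θ hθ => ?_
    obtain ⟨i, hi, hie⟩ := h₂ θ hθ
    calc ∫⁻ x, Φ x θ ∂Q ≤ ∫⁻ x, ∏ j, (r (x j) θ * (w i (x j))⁻¹) ∂Q := by
          refine lintegral_mono fun x => ?_
          by_cases hxR : x ∈ ⋃ i ∈ F, R i
          · simp only [Φ]; rw [indicator_of_notMem (by simpa using hxR)]; simp
          · have h1 : Φ x θ = likRatio r x θ := by
              simp only [Φ]; rw [indicator_of_mem (by exact hxR)]; simp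
            have h2 : ∏ j, w i (x j) ≤ 1 := by
              simp only [mem_iUnion, not_exists] at hxR
              exact (not_le.1 (hxR i hi)).le
            simp only [h1, Finset.prod_mul_distrib, likRatio]
            have h3 : (1 : ℝ≥0∞) ≤ ∏ j, (w i (x j))⁻¹ := by
              rw [← ENNReal.prod_inv_distrib (fun a _ b _ _ => Or.inl (hw0 i _))]
              exact ENNReal.one_le_inv.2 h2
            calc _ = (∏ j, r (x j) θ) * 1 := (mul_one _).symm
              _ ≤ _ := by gcongr
      _ = (∫⁻ y, r y θ * (w i y)⁻¹ ∂P) ^ n := by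
          rw [lintegral_pi_prod P (fun _ y => r y θ * (w i y)⁻¹)
            (fun _ => (hr.comp measurable_prodMk_right).mul (hw i).inv)]
          simp
      _ ≤ e ^ n := pow_le_pow_left' hie n

/-- Lower bound on the integrated likelihood ratio over a set of parameters whose inverse
likelihood ratio has controlled moments of order `α`. -/
lemma measure_setLIntegral_likRatio_lt_le (hr : Measurable (Function.uncurry r))
    (hr0 : ∀ x θ, r x θ ≠ 0)
    {S : Set Θ} (hS : MeasurableSet S) {α t : ℝ} (hα : 0 < α)
    (h : ∀ θ ∈ S, ∫⁻ y, (r y θ)⁻¹ ^ α ∂P ≤ ENNReal.ofReal (Real.exp (α * t))) :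
    (Measure.pi fun _ : Fin n => P) {x | ∫⁻ θ in S, likRatio r x θ ∂π
      < 2⁻¹ * π S * ENNReal.ofReal (Real.exp (-(2 * n * t)))}
      ≤ 2 * ENNReal.ofReal (Real.exp (-(n * (α * t)))) := by
  rcases eq_or_ne (π S) 0 with hS0 | hS0
  · simp [hS0]
  set Q := Measure.pi fun _ : Fin n => P
  have hSt : π S ≠ ∞ := measure_ne_top _ _
  let Φ : (Fin n → E) → Θ → ℝ≥0∞ := fun x θ => ∏ j, (r (x j) θ)⁻¹ ^ α
  have hΦ : Measurable (Function.uncurry Φ) := by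
    have h : ∀ j : Fin n, Measurable fun z : (Fin n → E) × Θ => (r (z.1 j) z.2)⁻¹ ^ α := fun j =>
      (hr.comp (measurable_prodMk_eval j)).inv.pow_const α
    exact Finset.measurable_prod _ fun j _ => h j
  have hΦG : ∀ x θ, Φ x θ = (likRatio r x θ)⁻¹ ^ α := fun x θ => by
    simp only [Φ, likRatio]
    rw [ENNReal.prod_rpow_of_nonneg hα.le,
      ← ENNReal.prod_inv_distrib (fun a _ b _ _ => Or.inl (hr0 _ _))]
  set ε : ℝ≥0∞ := ENNReal.ofReal (Real.exp (2 * n * (α * t))) with hε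
  have hε0 : ε ≠ 0 := by simp [hε, Real.exp_pos]
  have hεt : ε ≠ ∞ := ENNReal.ofReal_ne_top
  have hsub : {x : Fin n → E | ∫⁻ θ in S, likRatio r x θ ∂π
      < 2⁻¹ * π S * ENNReal.ofReal (Real.exp (-(2 * n * t)))} ⊆
      {x | 2⁻¹ * π S * ε ≤ ∫⁻ θ in S, Φ x θ ∂π} := by
    intro x hx
    -- If the integral of `Φ` is small, Markov over `θ` leaves at least half of the mass of `S` with
    -- `Φ x θ < ε`, and there the likelihood ratio exceeds `exp(-2nt)`.
    by_contra hcon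
    replace hcon : ∫⁻ θ in S, Φ x θ ∂π < 2⁻¹ * π S * ε := not_le.1 hcon
    rw [mem_ofPred_eq] at hx
    refine absurd hx (not_lt.2 ?_)
    have hΦx : Measurable (Φ x) := hΦ.of_uncurry_left
    set D := {θ | ε ≤ Φ x θ} with hD
    have hDm : MeasurableSet D := measurableSet_le measurable_const hΦx
    have h1 : π (D ∩ S) ≤ 2⁻¹ * π S := by
      have := meas_ge_le_lintegral_div (μ := π.restrict S) hΦx.aemeasurable hε0 hεt
      rw [Measure.restrict_apply hDm] at this
      refine this.trans ?_
      rw [ENNReal.div_le_iff hε0 hεt]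
      exact hcon.le
    have h2 : 2⁻¹ * π S ≤ π (S \ D) := by
      have h3 : π S ≤ π (D ∩ S) + π (S \ D) := by
        rw [inter_comm]; exact (measure_inter_add_sdiff S hDm).ge
      have h4 : π S = 2⁻¹ * π S + 2⁻¹ * π S := by
        rw [← add_mul, ENNReal.inv_two_add_inv_two, one_mul]
      have h5 : 2⁻¹ * π S + 2⁻¹ * π S ≤ 2⁻¹ * π S + π (S \ D) := by
        rw [← h4]; exact h3.trans (by gcongr)
      refine (ENNReal.add_le_add_iff_left ?_).1 h5
      exact ENNReal.mul_ne_top (by simp) hSt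
    calc 2⁻¹ * π S * ENNReal.ofReal (Real.exp (-(2 * n * t)))
        ≤ π (S \ D) * ENNReal.ofReal (Real.exp (-(2 * n * t))) := by gcongr
      _ = ∫⁻ _ in S \ D, ENNReal.ofReal (Real.exp (-(2 * n * t))) ∂π := by simp [mul_comm]
      _ ≤ ∫⁻ θ in S \ D, likRatio r x θ ∂π := by
          refine setLIntegral_mono' (hS.diff hDm) fun θ hθ => ?_
          have h6 : Φ x θ < ε := not_le.1 hθ.2
          rw [hΦG] at h6
          have h7 : ε = (ENNReal.ofReal (Real.exp (2 * n * t))) ^ α := by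
            rw [hε, ENNReal.ofReal_rpow_of_pos (Real.exp_pos _), ← Real.exp_mul]
            ring_nf
          rw [h7] at h6
          have h8 := (ENNReal.rpow_lt_rpow_iff hα).1 h6
          rw [Real.exp_neg, ENNReal.ofReal_inv_of_pos (Real.exp_pos _)]
          exact ENNReal.inv_le_iff_inv_le.1 h8.le
      _ ≤ ∫⁻ θ in S, likRatio r x θ ∂π := lintegral_mono_set sdiff_subset
  refine (measure_mono hsub).trans ?_
  have hκ0 : 2⁻¹ * π S * ε ≠ 0 := by simp [hS0, hε0]
  have hκt : 2⁻¹ * π S * ε ≠ ∞ := ENNReal.mul_ne_top (ENNReal.mul_ne_top (by simp) hSt) hεt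
  -- Markov over datasets: `Φ` has mean at most `exp(nαt)`, against a threshold carrying
  -- `exp(2nαt)`.
  refine (measure_le_setLIntegral_le Q π hS hΦ (B := ENNReal.ofReal (Real.exp (n * (α * t))))
    hκ0 hκt fun θ hθ => ?_).trans ?_
  · rw [lintegral_pi_prod P (fun _ y => (r y θ)⁻¹ ^ α)
      (fun _ => (hr.comp measurable_prodMk_right).inv.pow_const α)]
    simp only [Finset.prod_const, Finset.card_univ, Fintype.card_fin]
    refine (pow_le_pow_left' (h θ hθ) n).trans ?_
    rw [← ENNReal.ofReal_pow (Real.exp_pos _).le, ← Real.exp_nat_mul]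
  · rw [ENNReal.div_le_iff hκ0 hκt]
    have h9 : ENNReal.ofReal (Real.exp (-(n * (α * t)))) * ε
        = ENNReal.ofReal (Real.exp (n * (α * t))) := by
      rw [hε, ← ENNReal.ofReal_mul (Real.exp_pos _).le, ← Real.exp_add]
      ring_nf
    rw [← h9]
    calc _ = (2 * 2⁻¹) * (ENNReal.ofReal (Real.exp (-(n * (α * t)))) * ε * π S) := by
          rw [ENNReal.mul_inv_cancel (by simp) (by simp), one_mul]
      _ ≤ _ := le_of_eq (by ring)

/-- Pairs of observations and parameters in a small set contribute little to the integrated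
likelihood ratio. -/
lemma measure_le_setLIntegral_likRatio_le_of_exists (hr : Measurable (Function.uncurry r))
    {A : Set Θ} (hA : MeasurableSet A) (h : ∀ θ ∈ A, ∫⁻ y, r y θ ∂P ≤ 1)
    {D : Set (E × Θ)} (hD : MeasurableSet D) {κ : ℝ≥0∞} (hκ : κ ≠ 0) (hκ' : κ ≠ ∞) :
    (Measure.pi fun _ : Fin n => P)
        {x | κ ≤ ∫⁻ θ in A ∩ {θ | ∃ j, (x j, θ) ∈ D}, likRatio r x θ ∂π}
      ≤ n * (∫⁻ θ in A, ∫⁻ y, D.indicator 1 (y, θ) * r y θ ∂P ∂π) / κ := by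
  set Q := Measure.pi fun _ : Fin n => P
  -- The indicator acts on coordinate `i` only. By independence the other coordinates contribute
  -- factors at most one, so each `i` costs a single one-observation integral.
  let Ψ : Fin n → (Fin n → E) → Θ → ℝ≥0∞ := fun i x θ =>
    ∏ j, (if j = i then D.indicator 1 (x j, θ) else 1) * r (x j) θ
  have hI : Measurable (D.indicator (1 : E × Θ → ℝ≥0∞)) := measurable_one.indicator hD
  have hΨ : ∀ i, Measurable (Function.uncurry (Ψ i)) := fun i => by
    have h : ∀ j : Fin n, Measurable fun z : (Fin n → E) × Θ =>
        (if j = i then D.indicator 1 (z.1 j, z.2) else 1) * r (z.1 j) z.2 := fun j => by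
      refine Measurable.mul ?_ (hr.comp (measurable_prodMk_eval j))
      by_cases hji : j = i
      · simp only [hji, if_true]; exact hI.comp (measurable_prodMk_eval i)
      · simp [hji]
    exact Finset.measurable_prod _ fun j _ => h j
  have hle : ∀ x : Fin n → E, ∫⁻ θ in A ∩ {θ | ∃ j, (x j, θ) ∈ D}, likRatio r x θ ∂π
      ≤ ∫⁻ θ in A, ∑ i, Ψ i x θ ∂π := by
    intro x
    have hDx : MeasurableSet {θ | ∃ j, (x j, θ) ∈ D} := by
      rw [ofPred_exists]
      exact MeasurableSet.iUnion fun j => hD.preimage measurable_prodMk_left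
    rw [inter_comm, ← Measure.restrict_restrict hDx, ← lintegral_indicator hDx]
    refine lintegral_mono fun θ => ?_
    by_cases hθ : ∃ j, (x j, θ) ∈ D
    · obtain ⟨i, hi⟩ := hθ
      rw [indicator_of_mem (by exact ⟨i, hi⟩)]
      refine le_trans (le_of_eq ?_) (Finset.single_le_sum (fun _ _ => zero_le)
        (Finset.mem_univ i))
      refine Finset.prod_congr rfl fun j _ => ?_
      by_cases hji : j = i
      · subst hji; simp [hi]
      · simp [hji]
    · rw [indicator_of_notMem (by exact hθ)]; exact zero_le
  refine (measure_mono fun x hx => le_trans hx (hle x)).trans ?_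
  have hΨs : Measurable (Function.uncurry fun x θ => ∑ i, Ψ i x θ) :=
    Finset.measurable_sum _ fun i _ => hΨ i
  refine (meas_ge_le_lintegral_div
    (hΨs.lintegral_prod_right' (ν := π.restrict A)).aemeasurable hκ hκ').trans ?_
  gcongr
  calc _ = ∫⁻ θ in A, ∫⁻ x, ∑ i, Ψ i x θ ∂Q ∂π :=
        lintegral_lintegral_swap (f := fun x θ => ∑ i, Ψ i x θ) hΨs.aemeasurable
    _ ≤ ∫⁻ θ in A, n * ∫⁻ y, D.indicator 1 (y, θ) * r y θ ∂P ∂π := by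
        refine setLIntegral_mono' hA fun θ hθ => ?_
        have hΨθ : ∀ i, Measurable fun x => Ψ i x θ := fun i =>
          (hΨ i).comp measurable_prodMk_right
        rw [lintegral_finsetSum _ fun i _ => hΨθ i]
        calc _ ≤ ∑ _i : Fin n, ∫⁻ y, D.indicator 1 (y, θ) * r y θ ∂P := by
              refine Finset.sum_le_sum fun i _ => ?_
              have hm : ∀ j, Measurable fun y =>
                  (if j = i then D.indicator 1 (y, θ) else 1) * r y θ := fun j => by
                refine Measurable.mul ?_ (hr.comp measurable_prodMk_right)
                by_cases hji : j = i
                · simp only [hji, if_true]; exact hI.comp measurable_prodMk_right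
                · simp [hji]
              simp only [Ψ]
              rw [lintegral_pi_prod P (fun j y =>
                (if j = i then D.indicator 1 (y, θ) else 1) * r y θ) hm]
              rw [← Finset.mul_prod_erase _ _ (Finset.mem_univ i)]
              calc _ ≤ (∫⁻ y, (if i = i then D.indicator 1 (y, θ) else 1) * r y θ ∂P) * 1 := by
                    gcongr
                    refine Finset.prod_le_one' fun j hj => ?_
                    simpa [Finset.ne_of_mem_erase hj] using h θ hθ
                _ = _ := by simp
          _ = _ := by simp
    _ = _ := by
        rw [lintegral_const_mul]
        exact Measurable.lintegral_prod_left' (f := fun z : E × Θ => D.indicator 1 z * r z.1 z.2)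
          (hI.mul hr)

end Abstract

/-! ### Hellinger tests of a density against a small ball. -/

section HellingerTest

/-- Here `a, b, s, r` stand for the roots of the true density, the midpoint, the centre of the
alternative and a density near that centre. The midpoint keeps `v = a/b` at most `√2`, so replacing
`r` by `s` costs only a multiple of `(r - s)²`. For `r = s` the main inequality is `0 ≤ v (v - 1)²`.
-/
lemma sq_mul_div_le {a b s r : ℝ} (ha : 0 ≤ a) (hb : 0 < b) (h : 2 * b ^ 2 = a ^ 2 + s ^ 2) :
    r ^ 2 * (a / b) ≤ 3 * (a * b) - 2 * a ^ 2 + 9 / 2 * (r - s) ^ 2 + 1 / 2 * (a - b) ^ 2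
      + r ^ 2 - s ^ 2 := by
  obtain ⟨v, rfl⟩ : ∃ v, a = v * b := ⟨a / b, by field_simp⟩
  have hv : 0 ≤ v := nonneg_of_mul_nonneg_left ha hb
  rw [mul_div_cancel_right₀ _ hb.ne']
  have hb2 : 0 < b ^ 2 := by positivity
  have hs2 : s ^ 2 = b ^ 2 * (2 - v ^ 2) := by linarith [mul_pow v b 2]
  have hv2 : v ^ 2 ≤ 2 := by nlinarith [sq_nonneg s]
  have hv3 : v ≤ 3 / 2 := by nlinarith
  have h1 : s ^ 2 * v ≤ 3 * (v * b * b) - 2 * (v * b) ^ 2 := by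
    rw [hs2]
    nlinarith [mul_nonneg (mul_nonneg hv hb2.le) (sq_nonneg (v - 1))]
  have h2 : 2 * ((r - s) * (s * (v - 1))) ≤ 4 * (r - s) ^ 2 + 1 / 4 * (s * (v - 1)) ^ 2 := by
    nlinarith [sq_nonneg (2 * (r - s) - 1 / 2 * (s * (v - 1)))]
  have h3 : (s * (v - 1)) ^ 2 ≤ 2 * (v * b - b) ^ 2 := by
    rw [mul_pow, hs2]
    nlinarith [mul_nonneg hb2.le (mul_nonneg (sq_nonneg v) (sq_nonneg (v - 1)))]
  have h4 : (r - s) ^ 2 * (v - 1) ≤ 1 / 2 * (r - s) ^ 2 := by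
    nlinarith [sq_nonneg (r - s)]
  nlinarith

/-- From `s² - a² = 2 (b² - a²)`: factor both sides and use `b + a ≤ 2 (s + a)`. -/
lemma sq_sub_le_of_midpoint {a b s : ℝ} (ha : 0 ≤ a) (hb : 0 ≤ b) (hs : 0 ≤ s)
    (h : 2 * b ^ 2 = a ^ 2 + s ^ 2) : (s - a) ^ 2 ≤ 16 * (b - a) ^ 2 := by
  rcases (add_nonneg hs ha).eq_or_lt with h0 | h0
  · have : s = 0 := by linarith
    have : a = 0 := by linarith
    subst_vars; nlinarith [sq_nonneg (b - 0)]
  · have hbs : b ≤ s + a := by nlinarith [mul_nonneg hs ha]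
    have h1 : (s - a) * (s + a) = 2 * ((b - a) * (b + a)) := by linarith [h]
    have h2 : (s - a) ^ 2 * (s + a) ^ 2 = 4 * ((b - a) ^ 2 * (b + a) ^ 2) := by
      rw [← mul_pow, h1]; ring
    have h3 : (b + a) ^ 2 ≤ 4 * (s + a) ^ 2 := by nlinarith
    have h4 : (b - a) ^ 2 * (b + a) ^ 2 ≤ (b - a) ^ 2 * (4 * (s + a) ^ 2) :=
      mul_le_mul_of_nonneg_left h3 (sq_nonneg _)
    have h5 : (0 : ℝ) < (s + a) ^ 2 := by positivity
    refine le_of_mul_le_mul_right ?_ h5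
    nlinarith

variable {E : Type*} [MeasurableSpace E] {μ : Measure E}

lemma integrable_sqrt_mul_sqrt {q r : E → ℝ} (hq : Integrable q μ) (hr : Integrable r μ)
    (hq0 : ∀ᵐ x ∂μ, 0 ≤ q x) (hr0 : ∀ᵐ x ∂μ, 0 ≤ r x) :
    Integrable (fun x => Real.sqrt (q x) * Real.sqrt (r x)) μ := by
  refine (hq.add hr).mono' ?_ ?_
  · exact (Real.continuous_sqrt.comp_aestronglyMeasurable hq.1).mul
      (Real.continuous_sqrt.comp_aestronglyMeasurable hr.1)
  · filter_upwards [hq0, hr0] with x h1 h2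
    rw [Real.norm_of_nonneg (by positivity), Pi.add_apply]
    nlinarith [Real.sq_sqrt h1, Real.sq_sqrt h2, sq_nonneg (Real.sqrt (q x) - Real.sqrt (r x)),
      Real.sqrt_nonneg (q x), Real.sqrt_nonneg (r x)]

lemma sq_sqrt_sub_sqrt_ae_eq {q r : E → ℝ}
    (hq0 : ∀ᵐ x ∂μ, 0 ≤ q x) (hr0 : ∀ᵐ x ∂μ, 0 ≤ r x) :
    (fun x => (Real.sqrt (q x) - Real.sqrt (r x)) ^ 2) =ᵐ[μ]
      fun x => (q x + r x) - 2 * (Real.sqrt (q x) * Real.sqrt (r x)) := by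
  filter_upwards [hq0, hr0] with x h1 h2
  rw [sub_sq, Real.sq_sqrt h1, Real.sq_sqrt h2]; ring

lemma integrable_sq_sqrt_sub_sqrt {q r : E → ℝ} (hq : Integrable q μ) (hr : Integrable r μ)
    (hq0 : ∀ᵐ x ∂μ, 0 ≤ q x) (hr0 : ∀ᵐ x ∂μ, 0 ≤ r x) :
    Integrable (fun x => (Real.sqrt (q x) - Real.sqrt (r x)) ^ 2) μ :=
  ((hq.add hr).sub ((integrable_sqrt_mul_sqrt hq hr hq0 hr0).const_mul 2)).congr
    (sq_sqrt_sub_sqrt_ae_eq hq0 hr0).symm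

lemma integral_sqrt_mul_sqrt {q r : E → ℝ} (hq : Integrable q μ) (hr : Integrable r μ)
    (hq0 : ∀ᵐ x ∂μ, 0 ≤ q x) (hr0 : ∀ᵐ x ∂μ, 0 ≤ r x)
    (hq1 : ∫ x, q x ∂μ = 1) (hr1 : ∫ x, r x ∂μ = 1) :
    ∫ x, Real.sqrt (q x) * Real.sqrt (r x) ∂μ
      = 1 - 1 / 2 * ∫ x, (Real.sqrt (q x) - Real.sqrt (r x)) ^ 2 ∂μ := by
  rw [integral_congr_ae (sq_sqrt_sub_sqrt_ae_eq hq0 hr0), integral_sub (hq.fun_add hr)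
    ((integrable_sqrt_mul_sqrt hq hr hq0 hr0).const_mul 2), integral_add hq hr, hq1, hr1,
    integral_const_mul]
  ring

/-- `p` is a strictly positive probability density with respect to `μ`. -/
structure IsPosDensity (μ : Measure E) (p : E → ℝ) : Prop where
  integrable : Integrable p μ
  pos : ∀ x, 0 < p x
  integral_eq : ∫ x, p x ∂μ = 1

variable {p q₁ q : E → ℝ} {φ : ℝ}

/-- The Hellinger distance of `p` to the midpoint of `p` and `q₁` is comparable to that of
`p` and `q₁`. -/
lemma sq_div_le_hellinger_midpoint (Hp : IsPosDensity μ p) (Hq₁ : IsPosDensity μ q₁)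
    (hφ : φ ^ 2 ≤ 1 / 2 * ∫ x, (Real.sqrt (q₁ x) - Real.sqrt (p x)) ^ 2 ∂μ) :
    φ ^ 2 / 16
      ≤ 1 / 2 * ∫ x, (Real.sqrt ((p x + q₁ x) / 2) - Real.sqrt (p x)) ^ 2 ∂μ := by
  have ⟨hp, hp0, _⟩ := Hp
  have ⟨hq₁, hq₁0, _⟩ := Hq₁
  have hp0' : ∀ᵐ x ∂μ, 0 ≤ p x := ae_of_all _ fun x => (hp0 x).le
  have hq0' : ∀ᵐ x ∂μ, 0 ≤ q₁ x := ae_of_all _ fun x => (hq₁0 x).le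
  have hm0' : ∀ᵐ x ∂μ, 0 ≤ (p x + q₁ x) / 2 := ae_of_all _ fun x => by
    have := hp0 x; have := hq₁0 x; positivity
  have h : ∫ x, (Real.sqrt (q₁ x) - Real.sqrt (p x)) ^ 2 ∂μ
      ≤ ∫ x, 16 * (Real.sqrt ((p x + q₁ x) / 2) - Real.sqrt (p x)) ^ 2 ∂μ := by
    refine integral_mono (integrable_sq_sqrt_sub_sqrt hq₁ hp hq0' hp0')
      ((integrable_sq_sqrt_sub_sqrt ((hp.add hq₁).div_const 2) hp hm0' hp0').const_mul 16)
      fun x => ?_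
    have h1 := (hp0 x).le
    have h2 := (hq₁0 x).le
    refine sq_sub_le_of_midpoint (Real.sqrt_nonneg _) (Real.sqrt_nonneg _) (Real.sqrt_nonneg _) ?_
    rw [Real.sq_sqrt h1, Real.sq_sqrt h2, Real.sq_sqrt (by positivity)]; ring
  rw [integral_const_mul] at h
  linarith

/-- First-kind error of the test of `p` against a neighbourhood of `q₁`. -/
lemma lintegral_sqrt_midpoint_le (Hp : IsPosDensity μ p) (Hq₁ : IsPosDensity μ q₁)
    (hφ : φ ^ 2 ≤ 1 / 2 * ∫ x, (Real.sqrt (q₁ x) - Real.sqrt (p x)) ^ 2 ∂μ) :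
    ∫⁻ x, ENNReal.ofReal (Real.sqrt ((p x + q₁ x) / 2) * Real.sqrt (p x)) ∂μ
      ≤ ENNReal.ofReal (Real.exp (-(φ ^ 2 / 16))) := by
  have ⟨hp, hp0, hp1⟩ := Hp
  have ⟨hq₁, hq₁0, hq₁1⟩ := Hq₁
  have hp0' : ∀ᵐ x ∂μ, 0 ≤ p x := ae_of_all _ fun x => (hp0 x).le
  have hm0' : ∀ᵐ x ∂μ, 0 ≤ (p x + q₁ x) / 2 := ae_of_all _ fun x => by
    have := hp0 x; have := hq₁0 x; positivity
  have hm : Integrable (fun x => (p x + q₁ x) / 2) μ := (hp.add hq₁).div_const 2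
  have hm1 : ∫ x, (p x + q₁ x) / 2 ∂μ = 1 := by
    rw [integral_div, integral_add hp hq₁, hp1, hq₁1]; norm_num
  rw [← ofReal_integral_eq_lintegral_ofReal (integrable_sqrt_mul_sqrt hm hp hm0' hp0')
    (ae_of_all _ fun x => mul_nonneg (Real.sqrt_nonneg _) (Real.sqrt_nonneg _))]
  refine ENNReal.ofReal_le_ofReal ?_
  have := integral_sqrt_mul_sqrt hm hp hm0' hp0' hm1 hp1
  have h2 := sq_div_le_hellinger_midpoint Hp Hq₁ hφ
  rw [this]
  linarith [Real.add_one_le_exp (-(φ ^ 2 / 16))]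

/-- Second-kind error of the test of `p` against a neighbourhood of `q₁`. -/
lemma lintegral_mul_sqrt_div_midpoint_le (Hp : IsPosDensity μ p) (Hq₁ : IsPosDensity μ q₁)
    (hφ : φ ^ 2 ≤ 1 / 2 * ∫ x, (Real.sqrt (q₁ x) - Real.sqrt (p x)) ^ 2 ∂μ)
    (Hq : IsPosDensity μ q)
    (hu : 1 / 2 * ∫ x, (Real.sqrt (q x) - Real.sqrt (q₁ x)) ^ 2 ∂μ ≤ (φ / 12) ^ 2) :
    ∫⁻ x, ENNReal.ofReal (q x * (Real.sqrt (p x) / Real.sqrt ((p x + q₁ x) / 2))) ∂μ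
      ≤ ENNReal.ofReal (Real.exp (-(φ ^ 2 / 16))) := by
  have ⟨hp, hp0, hp1⟩ := Hp
  have ⟨hq₁, hq₁0, hq₁1⟩ := Hq₁
  have hp0' : ∀ᵐ x ∂μ, 0 ≤ p x := ae_of_all _ fun x => (hp0 x).le
  have ⟨hq, hq0, hq1⟩ := Hq
  have hq0' : ∀ᵐ x ∂μ, 0 ≤ q x := ae_of_all _ fun x => (hq0 x).le
  have hq₁0' : ∀ᵐ x ∂μ, 0 ≤ q₁ x := ae_of_all _ fun x => (hq₁0 x).le
  have hm0 : ∀ x, 0 < (p x + q₁ x) / 2 := fun x => by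
    have := hp0 x; have := hq₁0 x; positivity
  have hm0' : ∀ᵐ x ∂μ, 0 ≤ (p x + q₁ x) / 2 := ae_of_all _ fun x => (hm0 x).le
  have hm : Integrable (fun x => (p x + q₁ x) / 2) μ := (hp.add hq₁).div_const 2
  have hm1 : ∫ x, (p x + q₁ x) / 2 ∂μ = 1 := by
    rw [integral_div, integral_add hp hq₁, hp1, hq₁1]; norm_num
  -- With `H` the squared Hellinger distance of `p` to the midpoint, the integral of `R` is at most
  -- `3(1 - H) - 2 + 9(φ/12)² + H = 1 - 2H + φ²/16`. As `H ≥ φ²/16`, this is at most `1 - φ²/16`;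
  -- hence the radius `φ/12`.
  let R : E → ℝ := fun x => 3 * (Real.sqrt ((p x + q₁ x) / 2) * Real.sqrt (p x)) - 2 * p x
    + 9 / 2 * (Real.sqrt (q x) - Real.sqrt (q₁ x)) ^ 2
    + 1 / 2 * (Real.sqrt ((p x + q₁ x) / 2) - Real.sqrt (p x)) ^ 2 + q x - q₁ x
  have hle : ∀ x, q x * (Real.sqrt (p x) / Real.sqrt ((p x + q₁ x) / 2)) ≤ R x := fun x => by
    have h := sq_mul_div_le (a := Real.sqrt (p x)) (b := Real.sqrt ((p x + q₁ x) / 2))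
      (s := Real.sqrt (q₁ x)) (r := Real.sqrt (q x)) (Real.sqrt_nonneg _)
      (Real.sqrt_pos.2 (hm0 x)) (by
        rw [Real.sq_sqrt (hp0 x).le, Real.sq_sqrt (hq₁0 x).le, Real.sq_sqrt (hm0 x).le]; ring)
    rw [Real.sq_sqrt (hp0 x).le, Real.sq_sqrt (hq₁0 x).le, Real.sq_sqrt (hq0 x).le] at h
    simp only [R]
    nlinarith
  have i1 := (integrable_sqrt_mul_sqrt hm hp hm0' hp0').const_mul 3
  have i2 := hp.const_mul 2
  have i3 := (integrable_sq_sqrt_sub_sqrt hq hq₁ hq0' hq₁0').const_mul (9 / 2)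
  have i4 := (integrable_sq_sqrt_sub_sqrt hm hp hm0' hp0').const_mul (1 / 2)
  have hR : Integrable R μ := ((((i1.sub i2).add i3).add i4).add hq).sub hq₁
  have hRi : ∫ x, R x ∂μ = 3 * ∫ x, Real.sqrt ((p x + q₁ x) / 2) * Real.sqrt (p x) ∂μ - 2 * 1
      + 9 / 2 * ∫ x, (Real.sqrt (q x) - Real.sqrt (q₁ x)) ^ 2 ∂μ
      + 1 / 2 * ∫ x, (Real.sqrt ((p x + q₁ x) / 2) - Real.sqrt (p x)) ^ 2 ∂μ + 1 - 1 := by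
    simp only [R]
    have j2 : Integrable (fun x => 3 * (Real.sqrt ((p x + q₁ x) / 2) * Real.sqrt (p x))
      - 2 * p x) μ := i1.sub i2
    have j3 := j2.fun_add i3
    have j4 := j3.fun_add i4
    rw [integral_sub (j4.fun_add hq) hq₁, integral_add j4 hq, integral_add j3 i4,
      integral_add j2 i3, integral_sub i1 i2, hq1, hq₁1]
    simp only [integral_const_mul, hp1]
  calc _ ≤ ∫⁻ x, ENNReal.ofReal (R x) ∂μ :=
        lintegral_mono fun x => ENNReal.ofReal_le_ofReal (hle x)
    _ = ENNReal.ofReal (∫ x, R x ∂μ) := by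
        rw [ofReal_integral_eq_lintegral_ofReal hR]
        refine ae_of_all _ fun x => le_trans ?_ (hle x)
        exact mul_nonneg (hq0 x).le (div_nonneg (Real.sqrt_nonneg _) (Real.sqrt_nonneg _))
    _ ≤ _ := by
        refine ENNReal.ofReal_le_ofReal ?_
        rw [hRi, integral_sqrt_mul_sqrt hm hp hm0' hp0' hm1 hp1]
        have h2 := sq_div_le_hellinger_midpoint Hp Hq₁ hφ
        linarith [Real.add_one_le_exp (-(φ ^ 2 / 16))]

end HellingerTest

/-! ### The contaminated likelihood and moments of its inverse ratios. -/

/-- Joint convexity of `(a, b) ↦ a ^ (1 + α) / b ^ α` along segments towards `(c, c)`. -/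
lemma mul_div_rpow_le {a b c l α : ℝ} (ha : 0 ≤ a) (hb : 0 < b) (hc : 0 < c) (hl : 0 ≤ l)
    (hα : 0 < α) :
    (l * a + c) * ((l * a + c) / (l * b + c)) ^ α ≤ l * ((a / b) ^ α * a) + c := by
  have hd : 0 < l * b + c := by positivity
  have hn : 0 < l * a + c := by positivity
  have hx : a / b ∈ Ici (0 : ℝ) := by rw [mem_Ici]; positivity
  have hy : (1 : ℝ) ∈ Ici (0 : ℝ) := by simp
  have hw : 0 ≤ l * b / (l * b + c) := by positivity
  have hw' : 0 ≤ c / (l * b + c) := by positivity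
  -- The contaminated ratio is the average of `a/b` and `1` with weights proportional to `l b` and
  -- `c`; apply Jensen to `x ^ (1 + α)`.
  have hconv := (convexOn_rpow (p := 1 + α) (by linarith)).2 hx hy hw hw' (by field_simp)
  simp only [smul_eq_mul, mul_one, Real.one_rpow] at hconv
  have h1 : l * b / (l * b + c) * (a / b) + c / (l * b + c) = (l * a + c) / (l * b + c) := by
    field_simp
  rw [h1, Real.rpow_add (by positivity), Real.rpow_one] at hconv
  have h2 : (a / b) ^ (1 + α) = a / b * (a / b) ^ α := by
    rcases ha.eq_or_lt with rfl | ha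
    · simp [Real.zero_rpow (by linarith : 1 + α ≠ 0)]
    · rw [Real.rpow_add (by positivity), Real.rpow_one]
  rw [h2] at hconv
  have h3 := mul_le_mul_of_nonneg_left hconv hd.le
  calc _ = (l * b + c) * ((l * a + c) / (l * b + c) * ((l * a + c) / (l * b + c)) ^ α) := by
        field_simp
    _ ≤ _ := h3
    _ = _ := by field_simp

namespace ContaminationModel

variable {m d : ℕ} (M : ContaminationModel m d)

open Classical in
/-- The contaminated likelihood, extended by `1` off the observation and parameter spaces. -/
noncomputable def kExt (p : ℝ) (x : EuclideanSpace ℝ (Fin m)) (θ : EuclideanSpace ℝ (Fin d)) : ℝ :=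
  (M.obs ×ˢ M.par).piecewise (fun z => M.k p z.1 z.2) 1 (x, θ)

variable {M} {p : ℝ}

open Classical in
lemma kExt_of_mem {x : EuclideanSpace ℝ (Fin m)} {θ : EuclideanSpace ℝ (Fin d)}
    (hx : x ∈ M.obs) (hθ : θ ∈ M.par) : M.kExt p x θ = M.k p x θ :=
  piecewise_eq_of_mem _ _ _ (mk_mem_prod hx hθ)

lemma kExt_ae_eq {θ : EuclideanSpace ℝ (Fin d)} (hθ : θ ∈ M.par) :
    (fun x => M.kExt p x θ) =ᵐ[volume.restrict M.obs] fun x => M.k p x θ := by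
  filter_upwards [ae_restrict_mem M.measurableSet_obs] with x hx using kExt_of_mem hx hθ

lemma measurable_kExt : Measurable (Function.uncurry (M.kExt p)) := by
  classical
  have h : ContinuousOn (fun z : EuclideanSpace ℝ (Fin m) × EuclideanSpace ℝ (Fin d) =>
      M.k p z.1 z.2) (M.obs ×ˢ M.par) := by
    unfold k
    refine (continuousOn_const.mul M.continuousOn_f).add (continuousOn_const.mul ?_)
    exact M.continuousOn_g.comp continuousOn_fst fun z hz => hz.1
  exact h.measurable_piecewise continuousOn_const
    (M.measurableSet_obs.prod M.measurableSet_par)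

lemma measurable_kExt_left (θ : EuclideanSpace ℝ (Fin d)) :
    Measurable fun x => M.kExt p x θ := measurable_kExt.of_uncurry_right

lemma k_pos (hp : 0 < p) (hp1 : p < 1) {x : EuclideanSpace ℝ (Fin m)}
    {θ : EuclideanSpace ℝ (Fin d)} (hx : x ∈ M.obs) (hθ : θ ∈ M.par) : 0 < M.k p x θ := by
  have h1 := M.f_nonneg x hx θ hθ
  have h2 := M.g_pos x hx
  have h3 : 0 ≤ 1 - p := by linarith
  unfold k; positivity

-- The value one off the two spaces makes positivity hold everywhere, so the abstract lemmas, whose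
-- hypotheses quantify over all observations, apply directly.
open Classical in
lemma kExt_pos (hp : 0 < p) (hp1 : p < 1) (x : EuclideanSpace ℝ (Fin m))
    (θ : EuclideanSpace ℝ (Fin d)) : 0 < M.kExt p x θ := by
  by_cases h : (x, θ) ∈ M.obs ×ˢ M.par
  · rw [kExt_of_mem h.1 h.2]; exact k_pos hp hp1 h.1 h.2
  · unfold kExt; rw [piecewise_eq_of_notMem _ _ _ h]; exact one_pos

lemma integrable_f {θ : EuclideanSpace ℝ (Fin d)} (hθ : θ ∈ M.par) :
    Integrable (fun x => M.f x θ) (volume.restrict M.obs) :=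
  Integrable.of_integral_ne_zero (by rw [M.integral_f θ hθ]; exact one_ne_zero)

lemma integrable_g : Integrable M.g (volume.restrict M.obs) :=
  Integrable.of_integral_ne_zero (by rw [M.integral_g]; exact one_ne_zero)

lemma integrable_k {θ : EuclideanSpace ℝ (Fin d)} (hθ : θ ∈ M.par) :
    Integrable (fun x => M.k p x θ) (volume.restrict M.obs) :=
  ((integrable_f hθ).const_mul _).add (integrable_g.const_mul _)

lemma integral_k {θ : EuclideanSpace ℝ (Fin d)} (hθ : θ ∈ M.par) :
    ∫ x in M.obs, M.k p x θ = 1 := by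
  unfold k
  rw [integral_add ((integrable_f hθ).const_mul _) (integrable_g.const_mul _),
    integral_const_mul, integral_const_mul, M.integral_f θ hθ, M.integral_g]
  ring

lemma isPosDensity_kExt (hp : 0 < p) (hp1 : p < 1) {θ : EuclideanSpace ℝ (Fin d)}
    (hθ : θ ∈ M.par) : IsPosDensity (volume.restrict M.obs) fun x => M.kExt p x θ where
  integrable := (integrable_k hθ).congr (kExt_ae_eq hθ).symm
  pos x := kExt_pos hp hp1 x θ
  integral_eq := by rw [integral_congr_ae (kExt_ae_eq hθ), integral_k hθ]

lemma lintegral_kExt (hp : 0 < p) (hp1 : p < 1) {θ : EuclideanSpace ℝ (Fin d)}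
    (hθ : θ ∈ M.par) : ∫⁻ x in M.obs, ENNReal.ofReal (M.kExt p x θ) = 1 := by
  have h := isPosDensity_kExt hp hp1 hθ
  rw [← ofReal_integral_eq_lintegral_ofReal h.integrable (ae_of_all _ fun x => (h.pos x).le),
    h.integral_eq, ENNReal.ofReal_one]

lemma dataLaw_eq : M.dataLaw p =
    (volume.restrict M.obs).withDensity fun x => ENNReal.ofReal (M.kExt p x M.θstar) := by
  refine withDensity_congr_ae ?_
  filter_upwards [kExt_ae_eq (p := p) M.θstar_mem] with x hx using by rw [hx]

lemma isProbabilityMeasure_dataLaw (hp : 0 < p) (hp1 : p < 1) :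
    IsProbabilityMeasure (M.dataLaw p) := by
  refine ⟨?_⟩
  rw [dataLaw_eq, withDensity_apply _ MeasurableSet.univ, Measure.restrict_univ,
    lintegral_kExt hp hp1 M.θstar_mem]

variable (M p) in
/-- Likelihood ratio of one observation against the true parameter. -/
noncomputable def ratio (x : EuclideanSpace ℝ (Fin m)) (θ : EuclideanSpace ℝ (Fin d)) : ℝ≥0∞ :=
  ENNReal.ofReal (M.kExt p x θ) / ENNReal.ofReal (M.kExt p x M.θstar)

lemma ofReal_kExt_ne_zero (hp : 0 < p) (hp1 : p < 1) (x : EuclideanSpace ℝ (Fin m))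
    (θ : EuclideanSpace ℝ (Fin d)) : ENNReal.ofReal (M.kExt p x θ) ≠ 0 := by
  simpa using kExt_pos hp hp1 x θ

lemma measurable_ratio : Measurable (Function.uncurry (M.ratio p)) :=
  measurable_kExt.ennreal_ofReal.div
    (((measurable_kExt_left (M := M) (p := p) M.θstar).comp measurable_fst).ennreal_ofReal)

lemma ratio_ne_zero (hp : 0 < p) (hp1 : p < 1) (x : EuclideanSpace ℝ (Fin m))
    (θ : EuclideanSpace ℝ (Fin d)) : M.ratio p x θ ≠ 0 :=
  ENNReal.div_ne_zero.2 ⟨ofReal_kExt_ne_zero hp hp1 x θ, ENNReal.ofReal_ne_top⟩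

lemma lintegral_dataLaw {h : EuclideanSpace ℝ (Fin m) → ℝ≥0∞} (hh : Measurable h) :
    ∫⁻ x, h x ∂M.dataLaw p
      = ∫⁻ x in M.obs, ENNReal.ofReal (M.kExt p x M.θstar) * h x := by
  rw [dataLaw_eq, lintegral_withDensity_eq_lintegral_mul _
    (measurable_kExt_left M.θstar).ennreal_ofReal hh]
  rfl

/-- Change of measure from the true parameter to `θ`. -/
lemma lintegral_ratio_mul (hp : 0 < p) (hp1 : p < 1) (θ : EuclideanSpace ℝ (Fin d))
    {h : EuclideanSpace ℝ (Fin m) → ℝ≥0∞} (hh : Measurable h) :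
    ∫⁻ x, M.ratio p x θ * h x ∂M.dataLaw p
      = ∫⁻ x in M.obs, ENNReal.ofReal (M.kExt p x θ) * h x := by
  have hr : Measurable fun x => M.ratio p x θ := measurable_ratio.of_uncurry_right
  rw [lintegral_dataLaw (h := fun x => M.ratio p x θ * h x) (hr.mul hh)]
  refine lintegral_congr fun x => ?_
  rw [← mul_assoc, ratio, ENNReal.mul_div_cancel (ofReal_kExt_ne_zero hp hp1 x _)
    ENNReal.ofReal_ne_top]

lemma lintegral_ratio (hp : 0 < p) (hp1 : p < 1) {θ : EuclideanSpace ℝ (Fin d)}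
    (hθ : θ ∈ M.par) : ∫⁻ x, M.ratio p x θ ∂M.dataLaw p = 1 := by
  have := lintegral_ratio_mul (M := M) hp hp1 θ (h := 1) measurable_one
  simpa [lintegral_kExt hp hp1 hθ] using this

/-- Every `ρ`-neighbourhood of the true parameter in the uncontaminated model controls the inverse
likelihood ratios of the contaminated model. -/
lemma lintegral_inv_ratio_rpow_le (hp : 0 < p) (hp1 : p < 1) {α t : ℝ} (hα : 0 < α) (ht : 0 ≤ t)
    {θ : EuclideanSpace ℝ (Fin d)} (hθ : θ ∈ M.rhoBall 0 α t) :
    ∫⁻ x, (M.ratio p x θ)⁻¹ ^ α ∂M.dataLaw p ≤ ENNReal.ofReal (Real.exp (α * t)) := by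
  obtain ⟨hθp, hrho⟩ := hθ
  unfold rho at hrho
  set I : ℝ≥0∞ := ∫⁻ x in M.obs, (ENNReal.ofReal (M.k 0 x M.θstar) /
    ENNReal.ofReal (M.k 0 x θ)) ^ α * ENNReal.ofReal (M.k 0 x M.θstar) with hI
  have hIle : I ≤ ENNReal.ofReal (1 + α * t) := by
    -- An infinite moment would make `rho` equal to `⊤`, which no real `t` bounds.
    rcases eq_or_ne I ∞ with h | h
    · rw [h] at hrho
      have h1 : ((∞ : ℝ≥0∞) : EReal) - 1 = ⊤ := by
        rw [EReal.coe_ennreal_top]; exact EReal.top_sub_coe 1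
      rw [h1, EReal.coe_mul_top_of_pos (by positivity)] at hrho
      simp at hrho
    · have h1 : (I : EReal) = ((I.toReal : ℝ) : EReal) := (EReal.coe_ennreal_toReal h).symm
      rw [h1, ← EReal.coe_one, ← EReal.coe_sub, ← EReal.coe_mul, EReal.coe_le_coe_iff] at hrho
      rw [← ENNReal.ofReal_toReal h]
      refine ENNReal.ofReal_le_ofReal ?_
      rw [one_div, inv_mul_le_iff₀ hα] at hrho
      linarith
  have hr : Measurable fun x => M.ratio p x θ := measurable_ratio.of_uncurry_right
  rw [lintegral_dataLaw (h := fun x => (M.ratio p x θ)⁻¹ ^ α) (hr.inv.pow_const α)]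
  have hp0 : 0 ≤ 1 - p := by linarith
  calc ∫⁻ x in M.obs, ENNReal.ofReal (M.kExt p x M.θstar) * (M.ratio p x θ)⁻¹ ^ α
      ≤ ∫⁻ x in M.obs, (ENNReal.ofReal (1 - p) * ((ENNReal.ofReal (M.k 0 x M.θstar) /
        ENNReal.ofReal (M.k 0 x θ)) ^ α * ENNReal.ofReal (M.k 0 x M.θstar))
        + ENNReal.ofReal (p * M.g x)) := by
        refine setLIntegral_mono' M.measurableSet_obs fun x hx => ?_
        have hk := kExt_pos (M := M) hp hp1 x θ
        have hks := kExt_pos (M := M) hp hp1 x M.θstar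
        have hg : 0 < p * M.g x := mul_pos hp (M.g_pos x hx)
        have hf := M.f_nonneg x hx θ hθp
        have hfs := M.f_nonneg x hx _ M.θstar_mem
        have e1 : (M.ratio p x θ)⁻¹ ^ α
            = ENNReal.ofReal ((M.k p x M.θstar / M.k p x θ) ^ α) := by
          rw [← kExt_of_mem (p := p) hx hθp, ← kExt_of_mem (p := p) hx M.θstar_mem, ratio,
            ENNReal.inv_div (Or.inl ENNReal.ofReal_ne_top) (Or.inl (ofReal_kExt_ne_zero hp hp1 _ _)),
            ← ENNReal.ofReal_div_of_pos hk, ENNReal.ofReal_rpow_of_pos (div_pos hks hk)]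
        rw [e1, kExt_of_mem hx M.θstar_mem, ← ENNReal.ofReal_mul (by
          rw [← kExt_of_mem (p := p) hx M.θstar_mem]; exact hks.le)]
        have e2 : ∀ ϑ, M.k 0 x ϑ = M.f x ϑ := fun ϑ => by simp [k]
        simp only [e2]
        unfold k
        -- Where `f(x;θ)` vanishes, either `f(x;θ*)` vanishes too and both sides are `p g`, or the
        -- uncontaminated ratio is infinite and nothing is to be shown. Elsewhere convexity applies
        -- with `l = 1 - p` and `c = p g`.
        rcases hf.eq_or_lt with hf0 | hf0
        · rcases hfs.eq_or_lt with hfs0 | hfs0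
          · rw [← hf0, ← hfs0]
            simp [div_self hg.ne']
          · rw [← hf0]
            simp only [ENNReal.ofReal_zero]
            rw [ENNReal.div_zero (by simpa using hfs0), ENNReal.top_rpow_of_pos hα,
              ENNReal.top_mul (by simpa using hfs0), ENNReal.mul_top (by simpa using hp1), top_add]
            exact le_top
        · rw [← ENNReal.ofReal_div_of_pos hf0,
            ENNReal.ofReal_rpow_of_nonneg (by positivity) hα.le,
            ← ENNReal.ofReal_mul (by positivity), ← ENNReal.ofReal_mul hp0,
            ← ENNReal.ofReal_add (by positivity) hg.le]
          exact ENNReal.ofReal_le_ofReal (mul_div_rpow_le hfs hf0 hg hp0 hα)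
    _ = ENNReal.ofReal (1 - p) * I + ENNReal.ofReal p := by
        have hgi := integrable_g (M := M)
        rw [lintegral_add_right', lintegral_const_mul' _ _ ENNReal.ofReal_ne_top,
          ← ofReal_integral_eq_lintegral_ofReal (hgi.const_mul p), integral_const_mul,
          M.integral_g, mul_one]
        · filter_upwards [ae_restrict_mem M.measurableSet_obs] with x hx
            using mul_nonneg hp.le (M.g_pos x hx).le
        · exact (hgi.const_mul p).1.aemeasurable.ennreal_ofReal
    _ ≤ ENNReal.ofReal (1 - p) * ENNReal.ofReal (1 + α * t) + ENNReal.ofReal p := by gcongr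
    _ ≤ ENNReal.ofReal (Real.exp (α * t)) := by
        rw [← ENNReal.ofReal_mul hp0, ← ENNReal.ofReal_add (by positivity) hp.le]
        refine ENNReal.ofReal_le_ofReal ?_
        have : 0 ≤ α * t := by positivity
        nlinarith [Real.add_one_le_exp (α * t)]

end ContaminationModel

/-! ### Hellinger distances at different contamination levels. -/

lemma sq_sqrt_sub_sqrt_le_abs {a b : ℝ} (ha : 0 ≤ a) (hb : 0 ≤ b) :
    (Real.sqrt a - Real.sqrt b) ^ 2 ≤ |a - b| := by
  have h : a - b = (Real.sqrt a - Real.sqrt b) * (Real.sqrt a + Real.sqrt b) := by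
    nlinarith [Real.sq_sqrt ha, Real.sq_sqrt hb]
  rw [h, abs_mul, ← sq_abs, sq, abs_of_nonneg (a := Real.sqrt a + Real.sqrt b) (by positivity)]
  refine mul_le_mul_of_nonneg_left ?_ (abs_nonneg _)
  rw [abs_le]
  constructor <;> linarith [Real.sqrt_nonneg a, Real.sqrt_nonneg b]

/-- A weighted AM-GM inequality for `|√a - √b| * (√a + √b)`. It replaces Cauchy–Schwarz in bounding
L¹ by Hellinger distance; the weight is set to the Hellinger radius. -/
lemma abs_sub_le_sq_sqrt_sub_sqrt {a b φ : ℝ} (ha : 0 ≤ a) (hb : 0 ≤ b) (hφ : 0 < φ) :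
    |a - b| ≤ (2 * φ)⁻¹ * (Real.sqrt a - Real.sqrt b) ^ 2 + φ * (a + b) := by
  have h : a - b = (Real.sqrt a - Real.sqrt b) * (Real.sqrt a + Real.sqrt b) := by
    nlinarith [Real.sq_sqrt ha, Real.sq_sqrt hb]
  have h1 := Real.sq_sqrt ha
  have h2 := Real.sq_sqrt hb
  rw [h, abs_mul, abs_of_nonneg (a := Real.sqrt a + Real.sqrt b) (by positivity)]
  set s := |Real.sqrt a - Real.sqrt b|
  set t := Real.sqrt a + Real.sqrt b with ht
  have ht2 : t ^ 2 ≤ 2 * (a + b) := by nlinarith [sq_nonneg (Real.sqrt a - Real.sqrt b)]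
  rw [← sq_abs]
  have h3 : s * t ≤ (2 * φ)⁻¹ * s ^ 2 + φ / 2 * t ^ 2 := by
    have : (2 * φ)⁻¹ * s ^ 2 + φ / 2 * t ^ 2 - s * t = (2 * φ)⁻¹ * (s - φ * t) ^ 2 := by
      field_simp; ring
    have : 0 ≤ (2 * φ)⁻¹ * (s - φ * t) ^ 2 := by positivity
    linarith
  nlinarith

/-- Adding a constant to both arguments decreases the distance of the square roots. -/
lemma sq_sqrt_sub_sqrt_add_le {a b c l : ℝ} (ha : 0 ≤ a) (hb : 0 ≤ b) (hc : 0 ≤ c) (hl : 0 ≤ l)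
    (hl1 : l ≤ 1) : (Real.sqrt (l * a + c) - Real.sqrt (l * b + c)) ^ 2
      ≤ (Real.sqrt a - Real.sqrt b) ^ 2 := by
  have h1 : l * (Real.sqrt a * Real.sqrt b) + c ≤ Real.sqrt (l * a + c) * Real.sqrt (l * b + c) := by
    rw [← Real.sqrt_mul (by positivity : 0 ≤ l * a + c)]
    refine Real.le_sqrt_of_sq_le ?_
    have h2 : 2 * (Real.sqrt a * Real.sqrt b) ≤ a + b := by
      nlinarith [Real.sq_sqrt ha, Real.sq_sqrt hb, sq_nonneg (Real.sqrt a - Real.sqrt b)]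
    have h3 : (Real.sqrt a * Real.sqrt b) ^ 2 = a * b := by
      rw [mul_pow, Real.sq_sqrt ha, Real.sq_sqrt hb]
    have : l * c * (2 * (Real.sqrt a * Real.sqrt b)) ≤ l * c * (a + b) :=
      mul_le_mul_of_nonneg_left h2 (by positivity)
    calc (l * (Real.sqrt a * Real.sqrt b) + c) ^ 2 = l ^ 2 * (Real.sqrt a * Real.sqrt b) ^ 2
          + l * c * (2 * (Real.sqrt a * Real.sqrt b)) + c ^ 2 := by ring
      _ ≤ (l * a + c) * (l * b + c) := by rw [h3]; linarith
  have h4 : (Real.sqrt (l * a + c) - Real.sqrt (l * b + c)) ^ 2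
      ≤ l * (Real.sqrt a - Real.sqrt b) ^ 2 := by
    rw [sub_sq, sub_sq, Real.sq_sqrt ha, Real.sq_sqrt hb, Real.sq_sqrt (by positivity),
      Real.sq_sqrt (by positivity)]
    linarith
  nlinarith [sq_nonneg (Real.sqrt a - Real.sqrt b)]

namespace ContaminationModel

variable {m d : ℕ} {M : ContaminationModel m d} {p : ℝ}

lemma k_nonneg (hp : 0 ≤ p) (hp1 : p ≤ 1) {x : EuclideanSpace ℝ (Fin m)}
    {θ : EuclideanSpace ℝ (Fin d)} (hx : x ∈ M.obs) (hθ : θ ∈ M.par) : 0 ≤ M.k p x θ :=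
  add_nonneg (mul_nonneg (by linarith) (M.f_nonneg x hx θ hθ)) (mul_nonneg hp (M.g_pos x hx).le)

lemma k_zero (x : EuclideanSpace ℝ (Fin m)) (θ : EuclideanSpace ℝ (Fin d)) :
    M.k 0 x θ = M.f x θ := by simp [k]

lemma ae_k_nonneg (hp : 0 ≤ p) (hp1 : p ≤ 1) {θ : EuclideanSpace ℝ (Fin d)} (hθ : θ ∈ M.par) :
    ∀ᵐ x ∂volume.restrict M.obs, 0 ≤ M.k p x θ := by
  filter_upwards [ae_restrict_mem M.measurableSet_obs] with x hx using k_nonneg hp hp1 hx hθ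

lemma hell_sq (θ θ' : EuclideanSpace ℝ (Fin d)) : M.hell p θ θ' ^ 2 =
    1 / 2 * ∫ x in M.obs, (Real.sqrt (M.k p x θ) - Real.sqrt (M.k p x θ')) ^ 2 :=
  Real.sq_sqrt (mul_nonneg (by norm_num) (integral_nonneg fun _ => sq_nonneg _))

lemma hell_nonneg (θ θ' : EuclideanSpace ℝ (Fin d)) : 0 ≤ M.hell p θ θ' := Real.sqrt_nonneg _

lemma hell_self (θ : EuclideanSpace ℝ (Fin d)) : M.hell p θ θ = 0 := by
  simp [hell, hellinger]

lemma hell_sq_eq_kExt {θ θ' : EuclideanSpace ℝ (Fin d)} (hθ : θ ∈ M.par) (hθ' : θ' ∈ M.par) :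
    M.hell p θ θ' ^ 2 = 1 / 2 * ∫ x in M.obs,
      (Real.sqrt (M.kExt p x θ) - Real.sqrt (M.kExt p x θ')) ^ 2 := by
  rw [hell_sq]
  congr 1
  refine setIntegral_congr_fun M.measurableSet_obs fun x hx => ?_
  simp only [kExt_of_mem hx hθ, kExt_of_mem hx hθ']

lemma measurableSet_hell_gt {φ : ℝ} (hφ : 0 ≤ φ) :
    MeasurableSet {θ | θ ∈ M.par ∧ φ < M.hell p θ M.θstar} := by
  have h : {θ | θ ∈ M.par ∧ φ < M.hell p θ M.θstar} = M.par ∩ {θ | φ ^ 2 < 1 / 2 * ∫ x in M.obs,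
      (Real.sqrt (M.kExt p x θ) - Real.sqrt (M.kExt p x M.θstar)) ^ 2} := by
    ext θ
    refine and_congr_right fun hθ => ?_
    change _ ↔ φ ^ 2 < _
    rw [← hell_sq_eq_kExt hθ M.θstar_mem]
    exact (sq_lt_sq₀ hφ (hell_nonneg _ _)).symm
  rw [h]
  refine M.measurableSet_par.inter (measurableSet_lt measurable_const
    (measurable_const.mul ?_))
  have hm : Measurable fun z : EuclideanSpace ℝ (Fin d) × EuclideanSpace ℝ (Fin m) =>
      (Real.sqrt (M.kExt p z.2 z.1) - Real.sqrt (M.kExt p z.2 M.θstar)) ^ 2 := by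
    have h1 : Measurable fun z : EuclideanSpace ℝ (Fin d) × EuclideanSpace ℝ (Fin m) =>
        M.kExt p z.2 z.1 := measurable_kExt.comp measurable_swap
    have h2 : Measurable fun z : EuclideanSpace ℝ (Fin d) × EuclideanSpace ℝ (Fin m) =>
        M.kExt p z.2 M.θstar := (measurable_kExt_left M.θstar).comp measurable_snd
    exact (h1.sqrt.sub h2.sqrt).pow_const 2
  exact (hm.stronglyMeasurable.integral_prod_right (ν := volume.restrict M.obs)).measurable

lemma hell_le_one (hp : 0 ≤ p) (hp1 : p ≤ 1) {θ θ' : EuclideanSpace ℝ (Fin d)} (hθ : θ ∈ M.par)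
    (hθ' : θ' ∈ M.par) : M.hell p θ θ' ≤ 1 := by
  have h := integral_sqrt_mul_sqrt (integrable_k (p := p) hθ) (integrable_k hθ')
    (ae_k_nonneg hp hp1 hθ) (ae_k_nonneg hp hp1 hθ') (integral_k hθ) (integral_k hθ')
  rw [← hell_sq] at h
  have h2 : 0 ≤ ∫ x in M.obs, Real.sqrt (M.k p x θ) * Real.sqrt (M.k p x θ') :=
    integral_nonneg fun x => mul_nonneg (Real.sqrt_nonneg _) (Real.sqrt_nonneg _)
  nlinarith [hell_nonneg (M := M) (p := p) θ θ']

/-- A pointwise bound in the uncontaminated model bounds the Hellinger distance at every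
contamination level. -/
lemma hell_le_of_forall {r : ℝ} (hr : 0 ≤ r) (hp : 0 ≤ p) (hp1 : p ≤ 1)
    {θ θ' : EuclideanSpace ℝ (Fin d)} (hθ : θ ∈ M.par) (hθ' : θ' ∈ M.par)
    {B : EuclideanSpace ℝ (Fin m) → ℝ} (hB : Integrable B (volume.restrict M.obs))
    (h : ∀ x ∈ M.obs, (Real.sqrt (M.f x θ) - Real.sqrt (M.f x θ')) ^ 2 ≤ B x)
    (hBr : 1 / 2 * ∫ x in M.obs, B x ≤ r ^ 2) : M.hell p θ θ' ≤ r := by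
  refine (sq_le_sq₀ (hell_nonneg _ _) hr).1 ?_
  rw [hell_sq]
  refine le_trans (mul_le_mul_of_nonneg_left ?_ (by norm_num)) hBr
  refine integral_mono_of_nonneg (ae_of_all _ fun _ => sq_nonneg _) hB ?_
  filter_upwards [ae_restrict_mem M.measurableSet_obs] with x hx
  exact (sq_sqrt_sub_sqrt_add_le (M.f_nonneg x hx θ hθ) (M.f_nonneg x hx θ' hθ')
    (mul_nonneg hp (M.g_pos x hx).le) (by linarith) (by linarith)).trans (h x hx)

/-- Contamination decreases the Hellinger distance. -/
lemma hell_le_hell_zero (hp : 0 ≤ p) (hp1 : p ≤ 1) {θ θ' : EuclideanSpace ℝ (Fin d)}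
    (hθ : θ ∈ M.par) (hθ' : θ' ∈ M.par) : M.hell p θ θ' ≤ M.hell 0 θ θ' := by
  refine hell_le_of_forall (hell_nonneg _ _) hp hp1 hθ hθ'
    (integrable_sq_sqrt_sub_sqrt (integrable_k (p := 0) hθ) (integrable_k (p := 0) hθ')
      (ae_k_nonneg le_rfl zero_le_one hθ) (ae_k_nonneg le_rfl zero_le_one hθ'))
    (fun x _ => by simp only [k_zero]; exact le_rfl) (hell_sq _ _).ge

/-- The detour through L¹ reverses the contraction by contamination: `2 h₀² ≤ ‖f - f'‖₁`, `‖k - k'‖₁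
= (1 - p) ‖f - f'‖₁`, and `‖k - k'‖₁ ≤ h_p²/φ + 2φ ≤ 3φ`. -/
lemma hell_zero_sq_le (hp : 0 ≤ p) (hp1 : p < 1) {θ θ' : EuclideanSpace ℝ (Fin d)}
    (hθ : θ ∈ M.par) (hθ' : θ' ∈ M.par) {φ : ℝ} (hφ : 0 < φ) (h : M.hell p θ θ' ≤ φ) :
    (1 - p) * M.hell 0 θ θ' ^ 2 ≤ 3 / 2 * φ := by
  have i0 := integrable_sq_sqrt_sub_sqrt (integrable_k (p := 0) hθ) (integrable_k (p := 0) hθ')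
      (ae_k_nonneg le_rfl zero_le_one hθ) (ae_k_nonneg le_rfl zero_le_one hθ')
  have i1 := (integrable_sq_sqrt_sub_sqrt (integrable_k (p := p) hθ) (integrable_k (p := p) hθ')
      (ae_k_nonneg hp hp1.le hθ) (ae_k_nonneg hp hp1.le hθ')).const_mul (2 * φ)⁻¹
  have i3 := (integrable_k (p := p) hθ).fun_add (integrable_k (p := p) hθ')
  have i2 := i3.const_mul φ
  have hle : ∫ x in M.obs, (1 - p) * (Real.sqrt (M.k 0 x θ) - Real.sqrt (M.k 0 x θ')) ^ 2
      ≤ ∫ x in M.obs, ((2 * φ)⁻¹ * (Real.sqrt (M.k p x θ) - Real.sqrt (M.k p x θ')) ^ 2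
        + φ * (M.k p x θ + M.k p x θ')) := by
    refine setIntegral_mono_on (i0.const_mul _) (i1.add i2) M.measurableSet_obs fun x hx => ?_
    have h1 := sq_sqrt_sub_sqrt_le_abs (M.f_nonneg x hx θ hθ) (M.f_nonneg x hx θ' hθ')
    have h2 := abs_sub_le_sq_sqrt_sub_sqrt (k_nonneg hp hp1.le hx hθ)
      (k_nonneg hp hp1.le hx hθ') hφ
    have h3 : |M.k p x θ - M.k p x θ'| = (1 - p) * |M.f x θ - M.f x θ'| := by
      have h4 : M.k p x θ - M.k p x θ' = (1 - p) * (M.f x θ - M.f x θ') := by unfold k; ring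
      rw [h4, abs_mul, abs_of_nonneg (by linarith : 0 ≤ 1 - p)]
    rw [h3] at h2
    refine le_trans ?_ h2
    simp only [k_zero]
    exact mul_le_mul_of_nonneg_left h1 (by linarith)
  rw [integral_const_mul, integral_add i1 i2, integral_const_mul, integral_const_mul,
    integral_add (integrable_k hθ) (integrable_k hθ'), integral_k hθ, integral_k hθ'] at hle
  have e0 := hell_sq (M := M) (p := 0) θ θ'
  have e1 := hell_sq (M := M) (p := p) θ θ'
  have e2 : M.hell p θ θ' ^ 2 ≤ φ ^ 2 := pow_le_pow_left₀ (hell_nonneg _ _) h 2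
  have e3 : ∫ x in M.obs, (Real.sqrt (M.k p x θ) - Real.sqrt (M.k p x θ')) ^ 2 ≤ 2 * φ ^ 2 := by
    linarith
  have e4 := mul_le_mul_of_nonneg_left e3 (by positivity : 0 ≤ (2 * φ)⁻¹)
  have e5 : (2 * φ)⁻¹ * (2 * φ ^ 2) = φ := by field_simp
  rw [e0]
  linarith

/-- In an identifiable model the Hellinger balls shrink to the true parameter, whatever the
contamination. -/
lemma exists_tendsto_radiusBound (hid : M.IdentifiabilityAssumption) {φ p : ℕ → ℝ} {p₀ : ℝ}
    (hφ : ∀ n, 1 ≤ n → 0 < φ n) (hφ0 : Tendsto φ atTop (𝓝 0)) (hp₀ : p₀ < 1)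
    (hp : ∀ n, 1 ≤ n → 0 < p n ∧ p n ≤ p₀) :
    ∃ ψ : ℕ → ℝ, Tendsto ψ atTop (𝓝 0) ∧ ∀ᶠ n in atTop, M.RadiusBound (p n) (φ n) (ψ n) := by
  have key : ∀ ε : ℝ, 0 < ε → ∀ᶠ n in atTop, M.RadiusBound (p n) (φ n) ε := by
    intro ε hε
    obtain ⟨η, hη, h⟩ := hid ε hε
    have hη2 : 0 < (1 - p₀) * η ^ 2 / 2 := by
      have : 0 < 1 - p₀ := by linarith
      positivity
    filter_upwards [hφ0.eventually (gt_mem_nhds hη2), eventually_ge_atTop 1] with n hn hn1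
    intro θ hθ hθφ
    by_contra hcon
    have h1 := h θ hθ (not_le.1 hcon)
    have h2 := hell_zero_sq_le (hp n hn1).1.le ((hp n hn1).2.trans_lt hp₀) hθ M.θstar_mem
      (hφ n hn1) hθφ
    have h3 : η ^ 2 ≤ M.hell 0 θ M.θstar ^ 2 := pow_le_pow_left₀ hη.le h1 2
    have h4 : (1 - p₀) * η ^ 2 ≤ (1 - p n) * M.hell 0 θ M.θstar ^ 2 :=
      mul_le_mul (by linarith [(hp n hn1).2]) h3 (sq_nonneg _) (by linarith [(hp n hn1).2])
    linarith
  -- The supremum of `A n` is the smallest possible radius. For large `n` the set is bounded, by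
  -- `key`, so the supremum is not a default value.
  let A : ℕ → Set ℝ := fun n =>
    (fun θ => ‖θ - M.θstar‖) '' {θ | θ ∈ M.par ∧ M.hell (p n) θ M.θstar ≤ φ n}
  refine ⟨fun n => sSup (A n), ?_, ?_⟩
  · rw [Metric.tendsto_atTop]
    intro ε hε
    obtain ⟨N, hN⟩ := eventually_atTop.1 (key (ε / 2) (by positivity))
    refine ⟨N, fun n hn => ?_⟩
    have h0 : 0 ≤ sSup (A n) := Real.sSup_nonneg (by rintro _ ⟨θ, _, rfl⟩; exact norm_nonneg _)
    have h1 : sSup (A n) ≤ ε / 2 := Real.sSup_le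
      (by rintro _ ⟨θ, hθ, rfl⟩; exact hN n hn θ hθ.1 hθ.2) (by positivity)
    rw [Real.dist_eq, sub_zero, abs_of_nonneg h0]
    linarith
  · filter_upwards [key 1 one_pos] with n hn θ hθ hθφ
    exact le_csSup ⟨1, by rintro _ ⟨θ, hθ, rfl⟩; exact hn θ hθ.1 hθ.2⟩ ⟨θ, ⟨hθ, hθφ⟩, rfl⟩

/-- Unless the parameter space is a single point, every Hellinger ball contains another
parameter than the true one. -/
lemma exists_ne_hell_le {θ₁ : EuclideanSpace ℝ (Fin d)} (hθ₁ : θ₁ ∈ M.par) (hne : θ₁ ≠ M.θstar)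
    {φ : ℝ} (hφ : 0 < φ) : ∃ θ ∈ M.par, θ ≠ M.θstar ∧ M.hell 0 θ M.θstar ≤ φ := by
  let s : ℕ → ℝ := fun n => 1 / ((n : ℝ) + 1)
  have hs0 : ∀ n, 0 < s n := fun n => by positivity
  have hs1 : ∀ n, s n ≤ 1 := fun n => by
    simp only [s]; rw [div_le_one (by positivity)]; linarith [Nat.cast_nonneg (α := ℝ) n]
  let γ : ℕ → EuclideanSpace ℝ (Fin d) := fun n => M.θstar + s n • (θ₁ - M.θstar)
  have hγ : ∀ n, γ n ∈ M.par := fun n =>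
    M.convex_par.add_smul_sub_mem M.θstar_mem hθ₁ ⟨(hs0 n).le, hs1 n⟩
  have hγt : Tendsto γ atTop (𝓝 M.θstar) := by
    have h : Tendsto s atTop (𝓝 0) := tendsto_one_div_add_atTop_nhds_zero_nat
    simpa using tendsto_const_nhds.add (h.smul_const (θ₁ - M.θstar))
  have hpt : ∀ x ∈ M.obs, Tendsto (fun n => M.f x (γ n)) atTop (𝓝 (M.f x M.θstar)) := by
    intro x hx
    have hc := M.continuousOn_f (x, M.θstar) ⟨hx, M.θstar_mem⟩
    refine hc.tendsto.comp (tendsto_nhdsWithin_iff.2 ⟨?_, ?_⟩) (f := fun n => (x, γ n))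
    · exact tendsto_const_nhds.prodMk_nhds hγt
    · exact Eventually.of_forall fun n => ⟨hx, hγ n⟩
  -- Scheffé's argument: the positive part is dominated by `f(·;θ*)`, and as both densities have
  -- integral one it carries half of the L¹ distance.
  have hlim : Tendsto (fun n => ∫ x in M.obs, max (M.f x M.θstar - M.f x (γ n)) 0) atTop
      (𝓝 (∫ x in M.obs, (0 : ℝ))) := by
    refine tendsto_integral_of_dominated_convergence (fun x => M.f x M.θstar) (fun n => ?_)
      (integrable_f M.θstar_mem) (fun n => ?_) ?_
    · exact ((integrable_f M.θstar_mem).sub (integrable_f (hγ n))).pos_part.1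
    · filter_upwards [ae_restrict_mem M.measurableSet_obs] with x hx
      rw [Real.norm_of_nonneg (le_max_right _ _)]
      exact max_le (by linarith [M.f_nonneg x hx _ (hγ n)]) (M.f_nonneg x hx _ M.θstar_mem)
    · filter_upwards [ae_restrict_mem M.measurableSet_obs] with x hx
      simpa using (tendsto_const_nhds.sub (hpt x hx)).max
        (tendsto_const_nhds (x := (0 : ℝ))) (f := fun n => M.f x M.θstar - M.f x (γ n))
  rw [integral_zero] at hlim
  obtain ⟨n, hn⟩ := (hlim.eventually (gt_mem_nhds (by positivity : 0 < φ ^ 2))).exists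
  refine ⟨γ n, hγ n, ?_, ?_⟩
  · simp only [γ, ne_eq, add_eq_left, smul_eq_zero, sub_eq_zero, not_or]
    exact ⟨(hs0 n).ne', hne⟩
  · have i1 := (integrable_f (M := M) (hγ n)).sub (integrable_f M.θstar_mem)
    have i2 : Integrable (fun x => max (M.f x M.θstar - M.f x (γ n)) 0) (volume.restrict M.obs) :=
      ((integrable_f M.θstar_mem).sub (integrable_f (M := M) (hγ n))).pos_part
    have hB : Integrable (fun x => (M.f x (γ n) - M.f x M.θstar)
        + 2 * max (M.f x M.θstar - M.f x (γ n)) 0) (volume.restrict M.obs) :=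
      i1.add (i2.const_mul 2)
    refine hell_le_of_forall hφ.le le_rfl zero_le_one (hγ n) M.θstar_mem hB (fun x hx => ?_) ?_
    · refine (sq_sqrt_sub_sqrt_le_abs (M.f_nonneg x hx _ (hγ n))
        (M.f_nonneg x hx _ M.θstar_mem)).trans ?_
      rcases le_total (M.f x (γ n)) (M.f x M.θstar) with h | h
      · rw [abs_of_nonpos (by linarith), max_eq_left (by linarith)]; linarith
      · rw [abs_of_nonneg (by linarith), max_eq_right (by linarith)]; linarith
    · have e : ∫ x in M.obs, ((M.f x (γ n) - M.f x M.θstar)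
          + 2 * max (M.f x M.θstar - M.f x (γ n)) 0)
          = 2 * ∫ x in M.obs, max (M.f x M.θstar - M.f x (γ n)) 0 := by
        rw [integral_add (f := fun x => M.f x (γ n) - M.f x M.θstar) i1 (i2.const_mul 2),
          integral_sub (integrable_f (hγ n)) (integrable_f M.θstar_mem),
          M.integral_f _ (hγ n), M.integral_f _ M.θstar_mem, integral_const_mul]
        simp
      rw [e]
      linarith

end ContaminationModel

/-! ### From the entropy integral to a bracketing number. -/

section Bracketing

variable {m : ℕ} {X : Set (EuclideanSpace ℝ (Fin m))} {𝒬 : Set (EuclideanSpace ℝ (Fin m) → ℝ)}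

lemma HasBracketing.mono {r r' : ℝ} (hr : r ≤ r') {N : ℕ} (h : HasBracketing X r 𝒬 N) :
    HasBracketing X r' 𝒬 N := by
  obtain ⟨L, U, h1, h2⟩ := h
  exact ⟨L, U, fun j => ⟨(h1 j).1, (h1 j).2.1, (h1 j).2.2.1, (h1 j).2.2.2.1,
    (h1 j).2.2.2.2.trans hr⟩, h2⟩

lemma hasBracketing_toNat {r : ℝ} (h : bracketingNumber X r 𝒬 ≠ ⊤) :
    HasBracketing X r 𝒬 (bracketingNumber X r 𝒬).toNat := by
  classical
  have hex : ∃ N, HasBracketing X r 𝒬 N := by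
    by_contra hcon
    push Not at hcon
    exact h (by simp [bracketingNumber, hcon])
  have : bracketingNumber X r 𝒬 = (Nat.find hex : ℕ) := by
    refine le_antisymm (iInf₂_le _ (Nat.find_spec hex)) (le_iInf₂ fun N hN => ?_)
    exact_mod_cast Nat.find_min' hex hN
  rw [this, ENat.toNat_natCast]
  exact Nat.find_spec hex

lemma bracketingNumber_antitone {r r' : ℝ} (hr : r ≤ r') :
    bracketingNumber X r' 𝒬 ≤ bracketingNumber X r 𝒬 :=
  le_iInf₂ fun N hN => iInf₂_le N (hN.mono hr)

lemma sqrtBracketingEntropy_antitone {r r' : ℝ} (hr : r ≤ r') :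
    sqrtBracketingEntropy X r' 𝒬 ≤ sqrtBracketingEntropy X r 𝒬 := by
  have hle := bracketingNumber_antitone (X := X) (𝒬 := 𝒬) hr
  unfold sqrtBracketingEntropy
  by_cases h : bracketingNumber X r 𝒬 = ⊤
  · simp [h]
  · have h' : bracketingNumber X r' 𝒬 ≠ ⊤ := ne_top_of_le_ne_top h hle
    rw [if_neg h, if_neg h']
    refine ENNReal.ofReal_le_ofReal (Real.sqrt_le_sqrt ?_)
    have h2 := ENat.toNat_le_toNat hle h
    rcases Nat.eq_zero_or_pos (bracketingNumber X r' 𝒬).toNat with h0 | h0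
    · rw [h0]; simpa using Real.log_natCast_nonneg _
    · exact Real.log_le_log (by exact_mod_cast h0) (by exact_mod_cast h2)

/-- The entropy integral controls the bracketing number at a scale proportional to `φ`. -/
lemma exists_hasBracketing_le_exp {n : ℕ} {φ : ℝ} (hφ : 0 < φ) (hφ1 : φ < 1)
    (h : ∫⁻ u in Ioc (φ ^ 2 / 2 ^ 10) φ, sqrtBracketingEntropy X u 𝒬
      ≤ ENNReal.ofReal (1 / 100 * Real.sqrt n * φ ^ 2)) :
    ∃ N : ℕ, HasBracketing X (φ / 12) 𝒬 N ∧ (N : ℝ) ≤ Real.exp (n * (φ ^ 2 / 32)) := by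
  -- Entropy decreases in the scale, so on `(φ²/2¹⁰, φ/12]`, of length at least `φ/16`, it is at
  -- least its value at `φ/12`. Hence `√(log N) ≤ (16/100) √n φ`, and `(16/100)² ≤ 1/32`.
  have hlen : φ / 16 ≤ φ / 12 - φ ^ 2 / 2 ^ 10 := by nlinarith
  have h1 : sqrtBracketingEntropy X (φ / 12) 𝒬 * ENNReal.ofReal (φ / 16)
      ≤ ENNReal.ofReal (1 / 100 * Real.sqrt n * φ ^ 2) := by
    refine le_trans ?_ h
    calc _ ≤ sqrtBracketingEntropy X (φ / 12) 𝒬 * volume (Ioc (φ ^ 2 / 2 ^ 10) (φ / 12)) := by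
          rw [Real.volume_Ioc]; gcongr
      _ = ∫⁻ _ in Ioc (φ ^ 2 / 2 ^ 10) (φ / 12), sqrtBracketingEntropy X (φ / 12) 𝒬 := by simp
      _ ≤ ∫⁻ u in Ioc (φ ^ 2 / 2 ^ 10) (φ / 12), sqrtBracketingEntropy X u 𝒬 :=
          setLIntegral_mono' measurableSet_Ioc fun u hu => sqrtBracketingEntropy_antitone hu.2
      _ ≤ _ := lintegral_mono_set (Ioc_subset_Ioc_right (by linarith))
  have htop : bracketingNumber X (φ / 12) 𝒬 ≠ ⊤ := by
    intro htop
    rw [sqrtBracketingEntropy, if_pos htop, ENNReal.top_mul (by simpa using hφ)] at h1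
    exact ENNReal.ofReal_ne_top (top_le_iff.1 h1)
  refine ⟨_, hasBracketing_toNat htop, ?_⟩
  rw [sqrtBracketingEntropy, if_neg htop, ← ENNReal.ofReal_mul (Real.sqrt_nonneg _),
    ENNReal.ofReal_le_ofReal_iff (by positivity)] at h1
  set N := (bracketingNumber X (φ / 12) 𝒬).toNat
  rcases Nat.eq_zero_or_pos N with h0 | h0
  · rw [h0]; simpa using (Real.exp_pos _).le
  · have hN : (0 : ℝ) < N := by exact_mod_cast h0
    have hl : 0 ≤ Real.log N := Real.log_natCast_nonneg N
    rw [← Real.log_le_iff_le_exp hN]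
    have h2 : Real.sqrt (Real.log N) ≤ 16 / 100 * (Real.sqrt n * φ) := by
      refine le_of_mul_le_mul_right ?_ (by positivity : 0 < φ / 16)
      calc _ ≤ _ := h1
        _ = _ := by ring
    have h3 := pow_le_pow_left₀ (Real.sqrt_nonneg _) h2 2
    rw [Real.sq_sqrt hl, mul_pow, mul_pow, Real.sq_sqrt (Nat.cast_nonneg n)] at h3
    have : 0 ≤ (n : ℝ) * φ ^ 2 := by positivity
    linarith

end Bracketing

/-! ### Testing on the sieve, and growth of the likelihood along segments. -/

namespace ContaminationModel

variable {m d : ℕ} {M : ContaminationModel m d} {p : ℝ}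

/-- A bracketing yields a finite net of parameters. -/
lemma exists_finset_net (hp : 0 ≤ p) (hp1 : p ≤ 1) {A Om : Set (EuclideanSpace ℝ (Fin d))}
    (hA : A ⊆ Om) (hAp : A ⊆ M.par) {r : ℝ} {N : ℕ}
    (h : HasBracketing M.obs r ((fun θ x => M.f x θ) '' Om) N) :
    ∃ F : Finset (EuclideanSpace ℝ (Fin d)), ↑F ⊆ A ∧ F.card ≤ N ∧
      ∀ θ ∈ A, ∃ θ' ∈ F, M.hell p θ θ' ≤ r := by
  classical
  obtain ⟨L, U, hLU, hcov⟩ := h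
  let B : Fin N → Set (EuclideanSpace ℝ (Fin d)) := fun j =>
    {θ | θ ∈ A ∧ ∀ x ∈ M.obs, L j x ≤ M.f x θ ∧ M.f x θ ≤ U j x}
  -- Centres are parameters of `A`, since the tests need densities of the model that are themselves
  -- far from the truth. The default is discarded by the filter below.
  let c : Fin N → EuclideanSpace ℝ (Fin d) := fun j =>
    if hj : (B j).Nonempty then hj.choose else M.θstar
  have hc : ∀ j, (B j).Nonempty → c j ∈ B j := fun j hj => by
    simp only [c, dif_pos hj]; exact hj.choose_spec
  refine ⟨(Finset.univ.filter fun j => (B j).Nonempty).image c, ?_, ?_, ?_⟩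
  · intro θ hθ
    simp only [Finset.coe_image, Finset.coe_filter, Finset.mem_univ, true_and] at hθ
    obtain ⟨j, hj, rfl⟩ := hθ
    exact (hc j hj).1
  · calc _ ≤ _ := Finset.card_image_le
      _ ≤ _ := Finset.card_filter_le _ _
      _ = N := by simp
  · intro θ hθ
    obtain ⟨j, hj⟩ := hcov _ ⟨θ, hA hθ, rfl⟩
    have hθB : θ ∈ B j := ⟨hθ, hj⟩
    have hcB := hc j ⟨θ, hθB⟩
    refine ⟨c j, Finset.mem_image_of_mem _ (Finset.mem_filter.2 ⟨Finset.mem_univ _, ⟨θ, hθB⟩⟩), ?_⟩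
    obtain ⟨hLi, hUi, hL0, hU0, hh⟩ := hLU j
    have hL0' : ∀ᵐ x ∂volume.restrict M.obs, 0 ≤ L j x := by
      filter_upwards [ae_restrict_mem M.measurableSet_obs] with x hx using hL0 x hx
    have hU0' : ∀ᵐ x ∂volume.restrict M.obs, 0 ≤ U j x := by
      filter_upwards [ae_restrict_mem M.measurableSet_obs] with x hx using hU0 x hx
    have hr : 0 ≤ r := (Real.sqrt_nonneg _).trans hh
    refine hell_le_of_forall hr hp hp1 (hAp hθ) (hAp hcB.1)
      (integrable_sq_sqrt_sub_sqrt hLi hUi hL0' hU0') (fun x hx => ?_) ?_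
    -- Two members of a bracket have roots at most `√U - √L` apart. Being pointwise, this bound
    -- survives contamination, so brackets of the `f` family serve every `p`.
    · have a1 := Real.sqrt_le_sqrt (hj x hx).1
      have a2 := Real.sqrt_le_sqrt (hj x hx).2
      have b1 := Real.sqrt_le_sqrt (hcB.2 x hx).1
      have b2 := Real.sqrt_le_sqrt (hcB.2 x hx).2
      refine sq_le_sq.2 ?_
      rw [abs_of_nonpos (by linarith : Real.sqrt (L j x) - Real.sqrt (U j x) ≤ 0), abs_le]
      constructor <;> linarith
    · exact (Real.sqrt_le_left hr).1 hh

/-- Parameters far from the true one in Hellinger distance have small integrated likelihood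
ratio. -/
lemma measure_le_setLIntegral_likRatio_le_of_hell (hp : 0 < p) (hp1 : p < 1) {n : ℕ} {φ : ℝ}
    (hφ : 0 < φ) {A Om : Set (EuclideanSpace ℝ (Fin d))} (hAm : MeasurableSet A) (hA : A ⊆ Om)
    (hAp : A ⊆ M.par) (hAφ : ∀ θ ∈ A, φ < M.hell p θ M.θstar)
    (hent : ∫⁻ u in Ioc (φ ^ 2 / 2 ^ 10) φ,
        sqrtBracketingEntropy M.obs u ((fun θ x => M.f x θ) '' Om)
      ≤ ENNReal.ofReal (1 / 100 * Real.sqrt n * φ ^ 2)) {κ : ℝ≥0∞} (hκ : κ ≠ 0) (hκ' : κ ≠ ∞) :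
    (Measure.pi fun _ : Fin n => M.dataLaw p)
        {x | κ ≤ ∫⁻ θ in A, likRatio (M.ratio p) x θ ∂M.prior}
      ≤ ENNReal.ofReal (Real.exp (-(n * (φ ^ 2 / 32))))
        + ENNReal.ofReal (Real.exp (-(n * (φ ^ 2 / 16)))) / κ := by
  have := isProbabilityMeasure_dataLaw (M := M) hp hp1
  have := M.isProbabilityMeasure_prior
  rcases A.eq_empty_or_nonempty with rfl | ⟨θ₀, hθ₀⟩
  · simp [hκ]
  -- No smallness of `φ` is assumed: the Hellinger distance is at most one, so for `φ ≥ 1` there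
  -- would be no far parameter.
  have hφ1 : φ < 1 := (hAφ θ₀ hθ₀).trans_le (hell_le_one hp.le hp1.le (hAp hθ₀) M.θstar_mem)
  obtain ⟨N, hN, hNexp⟩ := exists_hasBracketing_le_exp hφ hφ1 hent
  obtain ⟨F, hFA, hFN, hF⟩ := exists_finset_net hp.le hp1.le hA hAp hN
  let mid : EuclideanSpace ℝ (Fin d) → EuclideanSpace ℝ (Fin m) → ℝ := fun θ' x =>
    (M.kExt p x M.θstar + M.kExt p x θ') / 2
  have hks : ∀ x, 0 < M.kExt p x M.θstar := fun x => kExt_pos hp hp1 x _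
  have hmid : ∀ θ' x, 0 < mid θ' x := fun θ' x => by
    have h1 := hks x
    have h2 := kExt_pos (M := M) hp hp1 x θ'
    simp only [mid]; positivity
  have hmidm : ∀ θ', Measurable (mid θ') := fun θ' =>
    ((measurable_kExt_left _).add (measurable_kExt_left _)).div_const 2
  -- The weight is the root of the likelihood ratio of the midpoint to the truth; its two error
  -- integrals are exactly those bounded by the midpoint lemmas.
  let w : EuclideanSpace ℝ (Fin d) → EuclideanSpace ℝ (Fin m) → ℝ≥0∞ := fun θ' x =>
    ENNReal.ofReal (Real.sqrt (mid θ' x) / Real.sqrt (M.kExt p x M.θstar))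
  have hw : ∀ θ', Measurable (w θ') := fun θ' =>
    ((hmidm θ').sqrt.div (measurable_kExt_left _).sqrt).ennreal_ofReal
  have hwpos : ∀ θ' x, 0 < Real.sqrt (mid θ' x) / Real.sqrt (M.kExt p x M.θstar) := fun θ' x =>
    div_pos (Real.sqrt_pos.2 (hmid θ' x)) (Real.sqrt_pos.2 (hks x))
  have hfar : ∀ θ' ∈ A, φ ^ 2 ≤ 1 / 2 * ∫ x in M.obs,
      (Real.sqrt (M.kExt p x θ') - Real.sqrt (M.kExt p x M.θstar)) ^ 2 := fun θ' hθ' => by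
    rw [← hell_sq_eq_kExt (hAp hθ') M.θstar_mem]
    exact pow_le_pow_left₀ hφ.le (hAφ θ' hθ').le 2
  have htest := measure_le_setLIntegral_likRatio_le_of_tests (n := n) (M.dataLaw p) M.prior
    (measurable_ratio (M := M) (p := p)) hAm F w hw (fun θ' x => by simpa [w] using hwpos θ' x)
    (e := ENNReal.ofReal (Real.exp (-(φ ^ 2 / 16)))) (fun θ' hθ' => ?_) (fun θ hθ => ?_) hκ hκ'
  · refine htest.trans (add_le_add ?_ ?_)
    · rw [← ENNReal.ofReal_pow (Real.exp_pos _).le, ← Real.exp_nat_mul, ← ENNReal.ofReal_natCast,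
        ← ENNReal.ofReal_mul (Nat.cast_nonneg _)]
      refine ENNReal.ofReal_le_ofReal ?_
      calc (F.card : ℝ) * Real.exp (n * -(φ ^ 2 / 16))
          ≤ Real.exp (n * (φ ^ 2 / 32)) * Real.exp (n * -(φ ^ 2 / 16)) := by
            gcongr
            exact le_trans (by exact_mod_cast hFN) hNexp
        _ = _ := by rw [← Real.exp_add]; ring_nf
    · gcongr
      rw [← ENNReal.ofReal_pow (Real.exp_pos _).le, ← Real.exp_nat_mul]
      calc _ ≤ ENNReal.ofReal (Real.exp (n * -(φ ^ 2 / 16))) * 1 := by gcongr; exact prob_le_one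
        _ = _ := by rw [mul_one]; ring_nf
  · refine le_trans (le_of_eq ?_) (lintegral_sqrt_midpoint_le
      (isPosDensity_kExt hp hp1 M.θstar_mem) (isPosDensity_kExt hp hp1 (hAp (hFA hθ')))
      (hfar θ' (hFA hθ')))
    rw [lintegral_dataLaw (hw θ')]
    refine lintegral_congr fun x => ?_
    rw [← ENNReal.ofReal_mul (hks x).le]
    congr 1
    have h1 := Real.sqrt_pos.2 (hks x)
    have h2 := Real.sq_sqrt (hks x).le
    change _ = Real.sqrt (mid θ' x) * _
    field_simp
    rw [h2, mul_comm]
  · obtain ⟨θ', hθ', hθθ'⟩ := hF θ hθ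
    refine ⟨θ', hθ', le_trans (le_of_eq ?_) (lintegral_mul_sqrt_div_midpoint_le
      (isPosDensity_kExt hp hp1 M.θstar_mem) (isPosDensity_kExt hp hp1 (hAp (hFA hθ')))
      (hfar θ' (hFA hθ')) (isPosDensity_kExt hp hp1 (hAp hθ)) ?_)⟩
    · rw [lintegral_ratio_mul hp hp1 θ (h := fun x => (w θ' x)⁻¹) (hw θ').inv]
      refine lintegral_congr fun x => ?_
      rw [← ENNReal.ofReal_inv_of_pos (hwpos θ' x), inv_div,
        ← ENNReal.ofReal_mul (kExt_pos hp hp1 x θ).le]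
    · rw [← hell_sq_eq_kExt (hAp hθ) (hAp (hFA hθ'))]
      exact pow_le_pow_left₀ (hell_nonneg _ _) hθθ' 2

/-- Growth of the likelihood along segments in the parameter space. -/
lemma f_sub_f_le (hT : M.TailAssumption) {ψ τ : ℝ} (hτ : M.DerivRatioBound ψ τ)
    {θ₁ θ₂ : EuclideanSpace ℝ (Fin d)} (h₁ : θ₁ ∈ M.par) (h₂ : θ₂ ∈ M.par)
    (h₁ψ : ‖θ₁ - M.θstar‖ ≤ ψ) (h₂ψ : ‖θ₂ - M.θstar‖ ≤ ψ)
    {x : EuclideanSpace ℝ (Fin m)} (hx : x ∈ M.obs) :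
    M.f x θ₂ - M.f x θ₁ ≤ τ * M.g x * ‖θ₂ - θ₁‖ := by
  rcases eq_or_ne θ₁ θ₂ with rfl | hne
  · simp
  set r := ‖θ₂ - θ₁‖ with hr
  have hr0 : 0 < r := norm_pos_iff.2 (sub_ne_zero.2 hne.symm)
  set u := r⁻¹ • (θ₂ - θ₁) with hu
  have hu1 : ‖u‖ = 1 := by
    rw [hu, norm_smul, norm_inv, Real.norm_of_nonneg hr0.le, ← hr, inv_mul_cancel₀ hr0.ne']
  have hru : θ₁ + r • u = θ₂ := by
    rw [hu, smul_smul, mul_inv_cancel₀ hr0.ne', one_smul, add_sub_cancel]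
  have hseg : ∀ s ∈ Icc 0 r, ∀ K : Set (EuclideanSpace ℝ (Fin d)), Convex ℝ K → θ₁ ∈ K → θ₂ ∈ K →
      θ₁ + s • u ∈ K := by
    intro s hs K hK hK1 hK2
    rw [hu, smul_smul]
    exact hK.add_smul_sub_mem hK1 hK2 ⟨mul_nonneg hs.1 (inv_nonneg.2 hr0.le), by
      rw [← div_eq_mul_inv, div_le_one hr0]; exact hs.2⟩
  have hpar : ∀ s ∈ Icc 0 r, θ₁ + s • u ∈ M.par := fun s hs => hseg s hs _ M.convex_par h₁ h₂
  have hball : ∀ s ∈ Icc 0 r, ‖θ₁ + s • u - M.θstar‖ ≤ ψ := fun s hs => by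
    rw [← mem_closedBall_iff_norm]
    exact hseg s hs _ (convex_closedBall _ _) (mem_closedBall_iff_norm.2 h₁ψ)
      (mem_closedBall_iff_norm.2 h₂ψ)
  let F : ℝ → ℝ := fun s => M.f x (θ₁ + s • u)
  have hFc : ContinuousOn F (Icc 0 r) := by
    refine M.continuousOn_f.comp (f := fun s : ℝ => (x, θ₁ + s • u)) ?_ fun s hs => ⟨hx, hpar s hs⟩
    exact Continuous.continuousOn (by fun_prop)
  have hF' : ∀ s ∈ Ico 0 r, HasDerivWithinAt F (dirDeriv (M.f x) (θ₁ + s • u) u) (Ici s) s ∧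
      dirDeriv (M.f x) (θ₁ + s • u) u ≤ τ * M.g x := by
    intro s hs
    have hs' : s ∈ Icc 0 r := ⟨hs.1, hs.2.le⟩
    -- For `s < r` the rest of the segment leads to `θ₂`. This gives right derivatives on `[0, r)`,
    -- all that the mean value inequality below needs.
    have hfeas : u ∈ feasibleDirections M.par (θ₁ + s • u) := by
      refine ⟨hu1, r - s, by linarith [hs.2], ?_⟩
      rw [add_assoc, ← add_smul, add_sub_cancel, hru]
      exact h₂
    obtain ⟨hdiff, B, hB⟩ := hT.1 x hx _ (hpar s hs')
    constructor
    · have h := (hdiff u hfeas).hasDerivWithinAt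
      have hsub : HasDerivWithinAt (fun t : ℝ => t - s) 1 (Ici s) s :=
        ((hasDerivAt_id s).sub_const s).hasDerivWithinAt
      have h0 : HasDerivWithinAt (fun ξ : ℝ => M.f x (θ₁ + s • u + ξ • u))
          (dirDeriv (M.f x) (θ₁ + s • u) u) (Ici 0) ((fun t : ℝ => t - s) s) := by
        simp only [sub_self]; exact h
      have h' := HasDerivWithinAt.comp (h := fun t : ℝ => t - s) s h0 hsub
        (fun t (ht : s ≤ t) => by simpa using ht)
      rw [mul_one] at h'
      refine h'.congr_of_mem (fun t _ => ?_) self_mem_Ici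
      simp only [F, Function.comp]
      congr 1
      module
    -- Pointwise boundedness of the directional derivatives makes `sSup` a genuine upper bound.
    · have h1 : dirDeriv (M.f x) (θ₁ + s • u) u ≤ M.supDirDeriv x (θ₁ + s • u) :=
        le_csSup ⟨B, by rintro _ ⟨v, hv, rfl⟩; exact (abs_le.1 (hB v hv)).2⟩ ⟨u, hfeas, rfl⟩
      have h2 := (le_abs_self _).trans (hτ _ (hpar s hs') (hball s hs') x hx)
      rw [div_le_iff₀ (M.g_pos x hx)] at h2
      exact h1.trans h2
  have hlin : ∀ s, HasDerivAt (fun s : ℝ => F 0 + τ * M.g x * s) (τ * M.g x) s := fun s => by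
    simpa using ((hasDerivAt_id s).const_mul (τ * M.g x)).const_add (F 0)
  have hmain := image_le_of_deriv_right_le_deriv_boundary hFc (fun s hs => (hF' s hs).1)
    (B := fun s => F 0 + τ * M.g x * s) (B' := fun _ => τ * M.g x) (by simp)
    (fun s _ => (hlin s).continuousAt.continuousWithinAt) (fun s _ => (hlin s).hasDerivWithinAt)
    (fun s hs => (hF' s hs).2) (right_mem_Icc.2 hr0.le)
  simp only [F, zero_smul, add_zero, hru] at hmain
  linarith

end ContaminationModel

/-! ### Comparing the posteriors of two fixed datasets. -/

section Privacy

variable {E Θ : Type*}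

/-- Common factors cancel. The two remaining ones are not compared directly but each with one, which
costs `c` twice; with `c = exp(ε̃/2)` the total is `exp ε̃`. -/
lemma likRatio_le_of_neighbouring {n : ℕ} {r : E → Θ → ℝ≥0∞} {x z : Fin n → E}
    (h : Neighbouring x z) {c : ℝ≥0∞} {θ : Θ} (hx : ∀ j, r (x j) θ ≤ c)
    (hz : ∀ j, 1 ≤ c * r (z j) θ) : likRatio r x θ ≤ c * c * likRatio r z θ := by
  obtain ⟨i, hi⟩ := h
  unfold likRatio
  rw [← Finset.mul_prod_erase _ _ (Finset.mem_univ i),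
    ← Finset.mul_prod_erase _ (fun j => r (z j) θ) (Finset.mem_univ i)]
  have h1 : ∏ j ∈ Finset.univ.erase i, r (x j) θ = ∏ j ∈ Finset.univ.erase i, r (z j) θ :=
    Finset.prod_congr rfl fun j hj => by rw [hi j (Finset.ne_of_mem_erase hj)]
  rw [h1, ← mul_assoc]
  gcongr
  calc r (x i) θ ≤ c * 1 := by rw [mul_one]; exact hx i
    _ ≤ c * (c * r (z i) θ) := by gcongr; exact hz i
    _ = _ := by ring

/-- Normalized integrals of two functions that are comparable off sets of small integral. -/
lemma setLIntegral_div_le [MeasurableSpace Θ] {π : Measure Θ} {G H : Θ → ℝ≥0∞} {A S U V : Set Θ}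
    (hA : MeasurableSet A) (hS : MeasurableSet S) (hU : MeasurableSet U) (hV : MeasurableSet V)
    (hSA : S ⊆ A) {c δ l κ : ℝ≥0∞} (hc0 : c ≠ 0) (hc : c ≠ ∞) (hδ : δ ≠ ∞) (hl : l ≠ 0)
    (hG : ∀ θ ∈ A, θ ∉ U → G θ ≤ c * H θ) (hH : ∀ θ ∈ A, θ ∉ V → H θ ≤ c * G θ)
    (hGU : ∫⁻ θ in A ∩ U, G θ ∂π ≤ κ) (hHV : ∫⁻ θ in A ∩ V, H θ ∂π ≤ κ)
    (hlG : l ≤ ∫⁻ θ in A, G θ ∂π) (hκ : κ ≤ δ * l) :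
    (∫⁻ θ in S, G θ ∂π) / (∫⁻ θ in A, G θ ∂π)
      ≤ c * (δ + c) * ((∫⁻ θ in S, H θ ∂π) / ∫⁻ θ in A, H θ ∂π) + δ := by
  set DG := ∫⁻ θ in A, G θ ∂π with hDG
  set DH := ∫⁻ θ in A, H θ ∂π with hDH
  have hκD : κ ≤ δ * DG := hκ.trans (by gcongr)
  have hD0 : DG ≠ 0 := fun h => hl (le_zero_iff.1 (h ▸ hlG))
  rcases eq_or_ne DG ∞ with hDt | hDt
  -- Division by an infinite normalizer gives zero.
  · rw [hDt, ENNReal.div_top]; exact zero_le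
  have bound : ∀ {F K : Θ → ℝ≥0∞} {B W : Set Θ}, MeasurableSet B → MeasurableSet W → B ⊆ A →
      (∀ θ ∈ A, θ ∉ W → F θ ≤ c * K θ) → ∫⁻ θ in A ∩ W, F θ ∂π ≤ κ →
      ∫⁻ θ in B, F θ ∂π ≤ c * (∫⁻ θ in B, K θ ∂π) + κ := by
    intro F K B W hB hW hBA hFK hFW
    rw [← lintegral_inter_add_sdiff F B hW, add_comm]
    refine add_le_add ?_ ((lintegral_mono_set (inter_subset_inter_left _ hBA)).trans hFW)
    calc ∫⁻ θ in B \ W, F θ ∂π ≤ ∫⁻ θ in B \ W, c * K θ ∂π :=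
          setLIntegral_mono' (hB.diff hW) fun θ hθ => hFK θ (hBA hθ.1) hθ.2
      _ ≤ ∫⁻ θ in B, c * K θ ∂π := lintegral_mono_set sdiff_subset
      _ = c * ∫⁻ θ in B, K θ ∂π := lintegral_const_mul' _ _ hc
  have h1 : ∫⁻ θ in S, G θ ∂π ≤ c * (∫⁻ θ in S, H θ ∂π) + δ * DG :=
    (bound hS hU hSA hG hGU).trans (by gcongr)
  -- Both error terms are measured against the normalizer of the first dataset, so a lower bound for
  -- that one suffices. Inverting this comparison produces the term `log(δ + exp ε̃)` of the privacy
  -- level.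
  have h2 : DH ≤ (δ + c) * DG := by
    refine (bound hA hV subset_rfl hH hHV).trans ?_
    rw [add_mul, add_comm]
    gcongr
  have h3 : DG⁻¹ ≤ (δ + c) * DH⁻¹ := by
    have hdc0 : δ + c ≠ 0 := by simp [hc0]
    have hdct : δ + c ≠ ∞ := ENNReal.add_ne_top.2 ⟨hδ, hc⟩
    have := ENNReal.inv_le_inv.2 h2
    rw [ENNReal.mul_inv (Or.inl hdc0) (Or.inl hdct)] at this
    calc DG⁻¹ = (δ + c) * ((δ + c)⁻¹ * DG⁻¹) := by
          rw [← mul_assoc, ENNReal.mul_inv_cancel hdc0 hdct, one_mul]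
      _ ≤ _ := by gcongr
  calc (∫⁻ θ in S, G θ ∂π) / DG ≤ (c * (∫⁻ θ in S, H θ ∂π) + δ * DG) / DG := by gcongr
    _ = c * (∫⁻ θ in S, H θ ∂π) * DG⁻¹ + δ := by
        rw [ENNReal.add_div, mul_div_assoc δ, ENNReal.div_self hD0 hDt, mul_one, div_eq_mul_inv]
    _ ≤ c * (∫⁻ θ in S, H θ ∂π) * ((δ + c) * DH⁻¹) + δ := by gcongr
    _ = _ := by rw [div_eq_mul_inv]; ring

end Privacy

lemma measure_pi_exists_mem_le {E : Type*} [MeasurableSpace E] {n : ℕ} (P : Measure E)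
    [IsProbabilityMeasure P] {s : Set E} (hs : MeasurableSet s) :
    (Measure.pi fun _ : Fin n => P) {x | ∃ j, x j ∈ s} ≤ n * P s := by
  have h : {x : Fin n → E | ∃ j, x j ∈ s} = ⋃ j, (fun x => x j) ⁻¹' s := by ext; simp
  rw [h]
  refine (measure_iUnion_fintype_le _ _).trans ?_
  calc _ ≤ ∑ _j : Fin n, P s := Finset.sum_le_sum fun j _ => by
        exact ((measurePreserving_eval (fun _ : Fin n => P) j).measure_preimage
          hs.nullMeasurableSet).le
    _ = _ := by simp

/-- Continuity from above: `R` is real-valued, so its superlevel sets decrease to the empty set. -/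
lemma exists_nat_measure_gt_le {α : Type*} [MeasurableSpace α] (ν : Measure α) [IsFiniteMeasure ν]
    {R : α → ℝ} (hR : Measurable R) {η : ℝ≥0∞} (hη : η ≠ 0) :
    ∃ V : ℕ, ∀ W : ℕ, V ≤ W → ν {z | (W : ℝ) < R z} ≤ η := by
  have hm : ∀ n : ℕ, MeasurableSet {z | (n : ℝ) < R z} := fun n =>
    measurableSet_lt measurable_const hR
  have h := tendsto_measure_iInter_atTop (μ := ν) (s := fun n : ℕ => {z | (n : ℝ) < R z})
    (fun n => (hm n).nullMeasurableSet)
    (fun a b hab z (hz : (b : ℝ) < R z) => lt_of_le_of_lt (Nat.cast_le.2 hab) hz)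
    ⟨0, measure_ne_top _ _⟩
  have he : ⋂ n : ℕ, {z | (n : ℝ) < R z} = ∅ := by
    refine eq_empty_of_forall_notMem fun z hz => ?_
    obtain ⟨n, hn⟩ := exists_nat_ge (R z)
    exact absurd (mem_iInter.1 hz n) (not_lt.2 hn)
  rw [he, measure_empty] at h
  exact eventually_atTop.1 (h.eventually_le_const (pos_iff_ne_zero.2 hη))

/-! ### From the random pair to control of each dataset. -/

namespace ContaminationModel

variable {m d : ℕ} {M : ContaminationModel m d} {p : ℝ}

lemma ratio_le_ofReal (hp : 0 < p) (hp1 : p < 1) {x : EuclideanSpace ℝ (Fin m)}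
    {θ : EuclideanSpace ℝ (Fin d)} (hx : x ∈ M.obs) (hθ : θ ∈ M.par) {c : ℝ} (hc : 0 ≤ c)
    (h : M.k p x θ ≤ c * M.k p x M.θstar) : M.ratio p x θ ≤ ENNReal.ofReal c := by
  rw [ratio, ENNReal.div_le_iff (ofReal_kExt_ne_zero hp hp1 _ _) ENNReal.ofReal_ne_top,
    ← ENNReal.ofReal_mul hc, kExt_of_mem hx hθ, kExt_of_mem hx M.θstar_mem]
  exact ENNReal.ofReal_le_ofReal h

lemma one_le_ofReal_mul_ratio (hp : 0 < p) (hp1 : p < 1) {x : EuclideanSpace ℝ (Fin m)}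
    {θ : EuclideanSpace ℝ (Fin d)} (hx : x ∈ M.obs) (hθ : θ ∈ M.par) {c : ℝ} (hc : 0 ≤ c)
    (h : M.k p x M.θstar ≤ c * M.k p x θ) : 1 ≤ ENNReal.ofReal c * M.ratio p x θ := by
  rw [ratio, ← mul_div_assoc, ENNReal.le_div_iff_mul_le
    (Or.inl (ofReal_kExt_ne_zero hp hp1 _ _)) (Or.inl ENNReal.ofReal_ne_top), one_mul,
    ← ENNReal.ofReal_mul hc, kExt_of_mem hx hθ, kExt_of_mem hx M.θstar_mem]
  exact ENNReal.ofReal_le_ofReal h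

/-- The likelihood at the true parameter is positive and finite and cancels. It links the posterior
to likelihood ratios, which have mean one under the data law. -/
lemma posterior_eq (hp : 0 < p) (hp1 : p < 1) {n : ℕ} {x : Fin n → EuclideanSpace ℝ (Fin m)}
    (hx : ∀ j, x j ∈ M.obs) {S : Set (EuclideanSpace ℝ (Fin d))} (hS : MeasurableSet S)
    (hSp : S ⊆ M.par) : M.posterior p x S = (∫⁻ θ in S, likRatio (M.ratio p) x θ ∂M.prior) /
      ∫⁻ θ in M.par, likRatio (M.ratio p) x θ ∂M.prior := by
  set L : ℝ≥0∞ := ∏ j, ENNReal.ofReal (M.kExt p (x j) M.θstar) with hL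
  have hL0 : L ≠ 0 := Finset.prod_ne_zero_iff.2 fun j _ => ofReal_kExt_ne_zero hp hp1 _ _
  have hLt : L ≠ ∞ := ENNReal.prod_ne_top fun j _ => ENNReal.ofReal_ne_top
  have key : ∀ {B : Set (EuclideanSpace ℝ (Fin d))}, MeasurableSet B → B ⊆ M.par →
      ∫⁻ θ in B, ∏ i, ENNReal.ofReal (M.k p (x i) θ) ∂M.prior
        = L * ∫⁻ θ in B, likRatio (M.ratio p) x θ ∂M.prior := by
    intro B hB hBp
    rw [← lintegral_const_mul' _ _ hLt]
    refine setLIntegral_congr_fun hB fun θ hθ => ?_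
    simp only [hL, likRatio]
    rw [← Finset.prod_mul_distrib]
    refine Finset.prod_congr rfl fun j _ => ?_
    rw [ratio, ENNReal.mul_div_cancel (ofReal_kExt_ne_zero hp hp1 _ _) ENNReal.ofReal_ne_top,
      kExt_of_mem (hx j) (hBp hθ)]
  rw [posterior, key hS hSp, key M.measurableSet_par subset_rfl,
    ENNReal.mul_div_mul_left _ _ hL0 hLt]

/-- The privacy inequality for two datasets whose likelihood ratios are controlled. -/
lemma posterior_le_of_ratio_le (hp : 0 < p) (hp1 : p < 1) {n : ℕ}
    {x z : Fin n → EuclideanSpace ℝ (Fin m)} (hxz : Neighbouring x z)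
    (hx : ∀ j, x j ∈ M.obs) (hz : ∀ j, z j ∈ M.obs) {U V : Set (EuclideanSpace ℝ (Fin d))}
    (hU : MeasurableSet U) (hV : MeasurableSet V) {ε δ : ℝ} (hδ : 0 < δ) {l κ : ℝ≥0∞} (hl : l ≠ 0)
    (hxU : ∀ θ ∈ M.par, θ ∉ U → ∀ j, M.ratio p (x j) θ ≤ ENNReal.ofReal (Real.exp (ε / 2)) ∧
      1 ≤ ENNReal.ofReal (Real.exp (ε / 2)) * M.ratio p (z j) θ)
    (hzV : ∀ θ ∈ M.par, θ ∉ V → ∀ j, M.ratio p (z j) θ ≤ ENNReal.ofReal (Real.exp (ε / 2)) ∧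
      1 ≤ ENNReal.ofReal (Real.exp (ε / 2)) * M.ratio p (x j) θ)
    (hκx : ∫⁻ θ in M.par ∩ U, likRatio (M.ratio p) x θ ∂M.prior ≤ κ)
    (hκz : ∫⁻ θ in M.par ∩ V, likRatio (M.ratio p) z θ ∂M.prior ≤ κ)
    (hlx : l ≤ ∫⁻ θ in M.par, likRatio (M.ratio p) x θ ∂M.prior)
    (hκl : κ ≤ ENNReal.ofReal δ * l) {S : Set (EuclideanSpace ℝ (Fin d))} (hS : MeasurableSet S)
    (hSp : S ⊆ M.par) :
    M.posterior p x S ≤ ENNReal.ofReal (Real.exp (ε + Real.log (δ + Real.exp ε)))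
      * M.posterior p z S + ENNReal.ofReal δ := by
  have hzx : Neighbouring z x := by
    obtain ⟨i, hi⟩ := hxz
    exact ⟨i, fun j hj => (hi j hj).symm⟩
  have hc : ENNReal.ofReal (Real.exp (ε / 2)) * ENNReal.ofReal (Real.exp (ε / 2))
      = ENNReal.ofReal (Real.exp ε) := by
    rw [← ENNReal.ofReal_mul (Real.exp_pos _).le, ← Real.exp_add, add_halves]
  have hc0 : ENNReal.ofReal (Real.exp ε) ≠ 0 := by simp [Real.exp_pos]
  rw [posterior_eq hp hp1 hx hS hSp, posterior_eq hp hp1 hz hS hSp]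
  have h := setLIntegral_div_le (π := M.prior) (G := likRatio (M.ratio p) x)
    (H := likRatio (M.ratio p) z) M.measurableSet_par hS hU hV hSp
    (c := ENNReal.ofReal (Real.exp ε)) (δ := ENNReal.ofReal δ) hc0 ENNReal.ofReal_ne_top
    ENNReal.ofReal_ne_top hl
    (fun θ hθ hθU => by
      rw [← hc]; exact likRatio_le_of_neighbouring hxz (fun j => (hxU θ hθ hθU j).1)
        (fun j => (hxU θ hθ hθU j).2))
    (fun θ hθ hθV => by
      rw [← hc]; exact likRatio_le_of_neighbouring hzx (fun j => (hzV θ hθ hθV j).1)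
        (fun j => (hzV θ hθ hθV j).2)) hκx hκz hlx hκl
  refine h.trans (le_of_eq ?_)
  congr 2
  rw [Real.exp_add, Real.exp_log (by positivity), ← ENNReal.ofReal_add hδ.le (Real.exp_pos _).le,
    ← ENNReal.ofReal_mul (Real.exp_pos _).le]

/-- Union bound over the two datasets of a random neighbouring pair. -/
lemma measure_privacyFailure_le {n : ℕ}
    {P : Measure ((Fin n → EuclideanSpace ℝ (Fin m)) × (Fin n → EuclideanSpace ℝ (Fin m)))}
    (hP : M.IsNeighbourLaw p n P) {ε δ : ℝ} {bad : Set (Fin n → EuclideanSpace ℝ (Fin m))}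
    {b : ℝ≥0∞} (hbad : (Measure.pi fun _ : Fin n => M.dataLaw p) bad ≤ b)
    (h : ∀ x z, x ∉ bad → z ∉ bad → Neighbouring x z →
      ∀ S : Set (EuclideanSpace ℝ (Fin d)), MeasurableSet S → S ⊆ M.par →
        M.posterior p x S ≤ ENNReal.ofReal (Real.exp ε) * M.posterior p z S + ENNReal.ofReal δ) :
    P (M.privacyFailure p n ε δ) ≤ 2 * b := by
  obtain ⟨h1, h2, h3⟩ := hP
  have hsub : M.privacyFailure p n ε δ ⊆ (Prod.fst ⁻¹' bad ∪ Prod.snd ⁻¹' bad)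
      ∪ {w | ¬ Neighbouring w.1 w.2} := by
    intro w hw
    by_contra hcon
    simp only [mem_union, mem_preimage, not_or] at hcon
    exact hw (h w.1 w.2 hcon.1.1 hcon.1.2 (not_not.1 hcon.2))
  have hnull : P {w | ¬ Neighbouring w.1 w.2} = 0 := h3
  calc P (M.privacyFailure p n ε δ)
      ≤ P (Prod.fst ⁻¹' bad ∪ Prod.snd ⁻¹' bad) + P {w | ¬ Neighbouring w.1 w.2} :=
        (measure_mono hsub).trans (measure_union_le _ _)
    _ ≤ (P (Prod.fst ⁻¹' bad) + P (Prod.snd ⁻¹' bad)) + 0 := by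
        rw [hnull]; gcongr; exact measure_union_le _ _
    -- `Measure.le_map_apply` holds for arbitrary sets, so neither the bad event nor the failure
    -- event needs to be measurable.
    _ ≤ (b + b) + 0 := by
        gcongr
        · exact (Measure.le_map_apply measurable_fst.aemeasurable _).trans (h1 ▸ hbad)
        · exact (Measure.le_map_apply measurable_snd.aemeasurable _).trans (h2 ▸ hbad)
    _ = 2 * b := by rw [add_zero, two_mul]

lemma measure_pi_exists_notMem_obs (hp : 0 < p) (hp1 : p < 1) (n : ℕ) :
    (Measure.pi fun _ : Fin n => M.dataLaw p) {x | ∃ j, x j ∈ M.obsᶜ} = 0 := by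
  have := isProbabilityMeasure_dataLaw (M := M) hp hp1
  refine le_zero_iff.1 ((measure_pi_exists_mem_le _ M.measurableSet_obs.compl).trans ?_)
  have h : M.dataLaw p M.obsᶜ = 0 := by
    rw [dataLaw, withDensity_apply _ M.measurableSet_obs.compl,
      Measure.restrict_restrict M.measurableSet_obs.compl]
    simp
  simp [h]

/-- The normalizing constant of the posterior is rarely small. -/
lemma measure_lintegral_par_lt_le (hp : 0 < p) (hp1 : p < 1) {n : ℕ} {α c₃ t : ℝ} (hα : 0 < α)
    (hc₃ : 0 < c₃) (ht : 0 ≤ t)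
    (h : ENNReal.ofReal (c₃ * Real.exp (-(2 * n * t))) ≤ M.prior (M.rhoBall 0 α t)) :
    (Measure.pi fun _ : Fin n => M.dataLaw p)
        {x | ∫⁻ θ in M.par, likRatio (M.ratio p) x θ ∂M.prior
          < ENNReal.ofReal (c₃ / 2 * Real.exp (-(4 * n * t)))}
      ≤ 2 * ENNReal.ofReal (Real.exp (-(n * (α * t)))) := by
  have := isProbabilityMeasure_dataLaw (M := M) hp hp1
  have := M.isProbabilityMeasure_prior
  -- A set defined by the moment bound itself: it is measurable and contains the `ρ`-ball, hence
  -- inherits its lower bound on prior mass.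
  let S : Set (EuclideanSpace ℝ (Fin d)) := M.par ∩
    {θ | ∫⁻ x, (M.ratio p x θ)⁻¹ ^ α ∂M.dataLaw p ≤ ENNReal.ofReal (Real.exp (α * t))}
  have hS : MeasurableSet S := by
    refine M.measurableSet_par.inter (measurableSet_le ?_ measurable_const)
    exact Measurable.lintegral_prod_left' (f := fun z : EuclideanSpace ℝ (Fin m) ×
      EuclideanSpace ℝ (Fin d) => (M.ratio p z.1 z.2)⁻¹ ^ α) (measurable_ratio.inv.pow_const α)
  have hsub : M.rhoBall 0 α t ⊆ S := fun θ hθ =>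
    ⟨hθ.1, lintegral_inv_ratio_rpow_le hp hp1 hα ht hθ⟩
  refine le_trans (measure_mono fun x hx => ?_) (measure_setLIntegral_likRatio_lt_le (n := n)
    (M.dataLaw p) M.prior measurable_ratio (ratio_ne_zero hp hp1) hS hα (t := t)
    fun θ hθ => hθ.2)
  refine lt_of_le_of_lt (lintegral_mono_set inter_subset_left) (lt_of_lt_of_le hx ?_)
  calc ENNReal.ofReal (c₃ / 2 * Real.exp (-(4 * n * t)))
      = 2⁻¹ * ENNReal.ofReal (c₃ * Real.exp (-(2 * n * t)))
        * ENNReal.ofReal (Real.exp (-(2 * n * t))) := by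
        have h2 : (2 : ℝ≥0∞)⁻¹ = ENNReal.ofReal (1 / 2) := by
          rw [one_div, ENNReal.ofReal_inv_of_pos two_pos]; simp
        rw [h2, ← ENNReal.ofReal_mul (by norm_num), ← ENNReal.ofReal_mul (by positivity)]
        congr 1
        have : Real.exp (-(4 * n * t)) = Real.exp (-(2 * n * t)) * Real.exp (-(2 * n * t)) := by
          rw [← Real.exp_add]; ring_nf
        rw [this]; ring
    _ ≤ 2⁻¹ * M.prior S * ENNReal.ofReal (Real.exp (-(2 * n * t))) := by
        gcongr
        exact h.trans (measure_mono hsub)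

/-- The contaminated likelihoods of parameters near the true one are comparable. -/
lemma k_le_exp_mul (hp : 0 < p) (hp1 : p < 1) (hT : M.TailAssumption) {ψ τ : ℝ}
    (hτ0 : 0 ≤ τ) (hτ : M.DerivRatioBound ψ τ) {θ₁ θ₂ : EuclideanSpace ℝ (Fin d)}
    (h₁ : θ₁ ∈ M.par) (h₂ : θ₂ ∈ M.par) (h₁ψ : ‖θ₁ - M.θstar‖ ≤ ψ) (h₂ψ : ‖θ₂ - M.θstar‖ ≤ ψ)
    (h₁₂ : ‖θ₂ - θ₁‖ ≤ ψ) {x : EuclideanSpace ℝ (Fin m)} (hx : x ∈ M.obs) :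
    M.k p x θ₂ ≤ Real.exp (epsTilde p τ ψ / 2) * M.k p x θ₁ := by
  have hg := M.g_pos x hx
  have h := f_sub_f_le hT hτ h₁ h₂ h₁ψ h₂ψ hx
  have hψ : 0 ≤ ψ := (norm_nonneg _).trans h₁ψ
  have h3 : τ * M.g x * ‖θ₂ - θ₁‖ ≤ τ * M.g x * ψ := by gcongr
  have he : epsTilde p τ ψ / 2 = (1 - p) * τ * ψ / p := by unfold epsTilde; ring
  set η := (1 - p) * τ * ψ / p with hη
  have hp' : 0 ≤ 1 - p := by linarith
  have hη0 : 0 ≤ η := by positivity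
  have hk : p * M.g x ≤ M.k p x θ₁ := by
    have := mul_nonneg hp' (M.f_nonneg x hx θ₁ h₁)
    unfold k; linarith
  -- The increment of the likelihood is a multiple of `g`, and `p g ≤ k_p`; so the additive bound
  -- becomes the factor `1 + η`.
  have h4 : M.k p x θ₂ ≤ M.k p x θ₁ + η * (p * M.g x) := by
    have h5 : η * (p * M.g x) = (1 - p) * (τ * M.g x * ψ) := by rw [hη]; field_simp
    have h6 := mul_le_mul_of_nonneg_left (h.trans h3) hp'
    rw [h5]; unfold k; linarith
  have hk0 := (k_pos hp hp1 hx h₁).le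
  rw [he]
  calc M.k p x θ₂ ≤ M.k p x θ₁ + η * M.k p x θ₁ := h4.trans (by gcongr)
    _ = (η + 1) * M.k p x θ₁ := by ring
    _ ≤ _ := by gcongr; exact Real.add_one_le_exp η

lemma nonempty_obs : M.obs.Nonempty := by
  rw [nonempty_iff_ne_empty]
  intro h
  have := M.integral_g
  rw [h] at this
  simp at this

end ContaminationModel

/-! ### Failure probability under a bound on the derivatives. -/

namespace ContaminationModel

variable {m d : ℕ} {M : ContaminationModel m d} {p : ℝ}

/-- An equality in fact: `δ_n` is the exceptional contribution divided by the lower bound on the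
normalizer, each of the two exponents on the right being `-n φ²/64`. -/
lemma two_mul_exp_le_deltaLevel_mul {n : ℕ} {φ c₃ : ℝ} (hc₃ : 0 < c₃) :
    2 * ENNReal.ofReal (Real.exp (-(n * (φ ^ 2 / 32)))) ≤
      ENNReal.ofReal (deltaLevel (1 / 32) c₃ n φ)
        * ENNReal.ofReal (c₃ / 2 * Real.exp (-(4 * n * (1 / 32 * φ ^ 2 / 8)))) := by
  have h2 : (2 : ℝ≥0∞) = ENNReal.ofReal 2 := by simp
  unfold deltaLevel
  rw [h2, ← ENNReal.ofReal_mul (by norm_num), ← ENNReal.ofReal_mul (by positivity)]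
  refine ENNReal.ofReal_le_ofReal (le_of_eq ?_)
  have : Real.exp (-(n * (φ ^ 2 / 32))) = Real.exp (-(1 / 2 * (1 / 32) * n * φ ^ 2))
      * Real.exp (-(4 * n * (1 / 32 * φ ^ 2 / 8))) := by
    rw [← Real.exp_add]; ring_nf
  rw [this]
  field_simp
  ring

lemma exp_rate_le {n : ℕ} {φ α : ℝ} :
    Real.exp (-(n * (φ ^ 2 / 32))) ≤ Real.exp (-(n * min (1 / 32 * α / 8) (1 / 32) * φ ^ 2)) := by
  refine Real.exp_le_exp.2 (neg_le_neg ?_)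
  have h := min_le_right (1 / 32 * α / 8) (1 / 32 : ℝ)
  have h2 : 0 ≤ (n : ℝ) * φ ^ 2 := by positivity
  calc _ = min (1 / 32 * α / 8) (1 / 32) * (n * φ ^ 2) := by ring
    _ ≤ 1 / 32 * (n * φ ^ 2) := by gcongr
    _ = _ := by ring

lemma exp_rate_le' {n : ℕ} {φ α : ℝ} :
    Real.exp (-(n * (α * (1 / 32 * φ ^ 2 / 8))))
      ≤ Real.exp (-(n * min (1 / 32 * α / 8) (1 / 32) * φ ^ 2)) := by
  refine Real.exp_le_exp.2 (neg_le_neg ?_)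
  have h := min_le_left (1 / 32 * α / 8) (1 / 32 : ℝ)
  have h2 : 0 ≤ (n : ℝ) * φ ^ 2 := by positivity
  calc _ = min (1 / 32 * α / 8) (1 / 32) * (n * φ ^ 2) := by ring
    _ ≤ 1 / 32 * α / 8 * (n * φ ^ 2) := by gcongr
    _ = _ := by ring

lemma deltaLevel_pos {c₁ c₃ : ℝ} (hc₃ : 0 < c₃) (n : ℕ) (φ : ℝ) : 0 < deltaLevel c₁ c₃ n φ := by
  unfold deltaLevel; positivity

/-- Failure probability of the privacy inequality when the derivative of the likelihood is
controlled over the Euclidean ball of radius `ψ`. -/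
lemma measure_privacyFailure_le_of_derivRatioBound (hp : 0 < p) (hp1 : p < 1) {n : ℕ}
    {φ α c₃ c₄ : ℝ} (hφ : 0 < φ) (hα : 0 < α) (hc₃ : 0 < c₃) (hc₄ : 0 < c₄)
    {Om : Set (EuclideanSpace ℝ (Fin d))}
    (hent : ∫⁻ u in Ioc (φ ^ 2 / 2 ^ 10) φ,
        sqrtBracketingEntropy M.obs u ((fun θ x => M.f x θ) '' Om)
      ≤ ENNReal.ofReal (1 / 100 * Real.sqrt n * φ ^ 2))
    (hcentre : ENNReal.ofReal (c₃ * Real.exp (-(2 * n * (1 / 32 * φ ^ 2 / 8))))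
      ≤ M.prior (M.rhoBall 0 α (1 / 32 * φ ^ 2 / 8)))
    (htail : M.prior (M.par \ Om)
      ≤ ENNReal.ofReal (c₄ * Real.exp (-(2 * (1 / 32) * n * φ ^ 2))))
    (hT : M.TailAssumption) {ψ τ : ℝ} (hψ : M.RadiusBound p φ ψ) (hτ : M.DerivRatioBound ψ τ)
    {P : Measure ((Fin n → EuclideanSpace ℝ (Fin m)) × (Fin n → EuclideanSpace ℝ (Fin m)))}
    (hP : M.IsNeighbourLaw p n P) :
    P (M.privacyFailure p n (epsLevel (deltaLevel (1 / 32) c₃ n φ) p τ ψ)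
        (deltaLevel (1 / 32) c₃ n φ))
      ≤ ENNReal.ofReal (2 * (4 + c₄) *
        Real.exp (-(n * min (1 / 32 * α / 8) (1 / 32) * φ ^ 2))) := by
  have := isProbabilityMeasure_dataLaw (M := M) hp hp1
  have := M.isProbabilityMeasure_prior
  set Q := Measure.pi fun _ : Fin n => M.dataLaw p
  set e : ℝ := Real.exp (-(n * min (1 / 32 * α / 8) (1 / 32) * φ ^ 2)) with he
  have he0 : 0 < e := Real.exp_pos _
  set κ : ℝ≥0∞ := ENNReal.ofReal (Real.exp (-(n * (φ ^ 2 / 32)))) with hκ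
  have hκ0 : κ ≠ 0 := by simp [hκ, Real.exp_pos]
  have hκt : κ ≠ ∞ := ENNReal.ofReal_ne_top
  set l : ℝ≥0∞ := ENNReal.ofReal (c₃ / 2 * Real.exp (-(4 * n * (1 / 32 * φ ^ 2 / 8)))) with hl
  have hl0 : l ≠ 0 := by
    rw [hl]; simp only [ne_eq, ENNReal.ofReal_eq_zero, not_le]; positivity
  let U : Set (EuclideanSpace ℝ (Fin d)) := {θ | θ ∈ M.par ∧ φ < M.hell p θ M.θstar}
  have hU : MeasurableSet U := measurableSet_hell_gt hφ.le
  -- The sieves need not be measurable; the hull has the same prior mass, and what lies outside it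
  -- within `M.par` is in the sieve.
  let W := toMeasurable M.prior (M.par \ Om)
  have hW : MeasurableSet W := measurableSet_toMeasurable _ _
  let bad₁ : Set (Fin n → EuclideanSpace ℝ (Fin m)) := {x | ∃ j, x j ∈ M.obsᶜ}
  let bad₂ : Set (Fin n → EuclideanSpace ℝ (Fin m)) :=
    {x | ∫⁻ θ in M.par, likRatio (M.ratio p) x θ ∂M.prior < l}
  let bad₃ : Set (Fin n → EuclideanSpace ℝ (Fin m)) :=
    {x | κ ≤ ∫⁻ θ in U \ W, likRatio (M.ratio p) x θ ∂M.prior}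
  let bad₄ : Set (Fin n → EuclideanSpace ℝ (Fin m)) :=
    {x | κ ≤ ∫⁻ θ in M.par ∩ W, likRatio (M.ratio p) x θ ∂M.prior}
  have h₁ : Q bad₁ = 0 := measure_pi_exists_notMem_obs hp hp1 n
  have h₂ : Q bad₂ ≤ ENNReal.ofReal (2 * e) := by
    refine (measure_lintegral_par_lt_le hp hp1 hα hc₃ (by positivity) hcentre).trans ?_
    rw [ENNReal.ofReal_mul two_pos.le, ENNReal.ofReal_ofNat]
    gcongr
    exact exp_rate_le'
  have h₃ : Q bad₃ ≤ ENNReal.ofReal (2 * e) := by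
    refine (measure_le_setLIntegral_likRatio_le_of_hell hp hp1 hφ (hU.diff hW) (Om := Om)
      (fun θ hθ => ?_) (fun θ hθ => hθ.1.1) (fun θ hθ => hθ.1.2) hent hκ0 hκt).trans ?_
    · by_contra hcon
      exact hθ.2 (subset_toMeasurable _ _ ⟨hθ.1.1, hcon⟩)
    · rw [hκ, ← ENNReal.ofReal_div_of_pos (Real.exp_pos _), ← Real.exp_sub,
        ← ENNReal.ofReal_add (Real.exp_pos _).le (Real.exp_pos _).le]
      refine ENNReal.ofReal_le_ofReal ?_
      have h5 : -(n * (φ ^ 2 / 16)) - -(n * (φ ^ 2 / 32)) = -(n * (φ ^ 2 / 32)) := by ring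
      rw [h5]
      linarith [exp_rate_le (n := n) (φ := φ) (α := α)]
  have h₄ : Q bad₄ ≤ ENNReal.ofReal (c₄ * e) := by
    refine (measure_le_setLIntegral_likRatio_le (M.dataLaw p) M.prior measurable_ratio
      (M.measurableSet_par.inter hW) (fun θ hθ => (lintegral_ratio hp hp1 hθ.1).le)
      hκ0 hκt).trans ?_
    calc M.prior (M.par ∩ W) / κ ≤ M.prior W / κ := by gcongr; exact inter_subset_right
      _ ≤ ENNReal.ofReal (c₄ * Real.exp (-(2 * (1 / 32) * n * φ ^ 2))) / κ := by
          rw [measure_toMeasurable]; gcongr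
      _ = ENNReal.ofReal (c₄ * Real.exp (-(n * (φ ^ 2 / 32)))) := by
          rw [hκ, ← ENNReal.ofReal_div_of_pos (Real.exp_pos _), mul_div_assoc, ← Real.exp_sub]
          ring_nf
      _ ≤ _ := by
          refine ENNReal.ofReal_le_ofReal ?_
          gcongr
          exact exp_rate_le
  have hbad : Q (((bad₁ ∪ bad₂) ∪ bad₃) ∪ bad₄) ≤ ENNReal.ofReal ((4 + c₄) * e) := by
    calc _ ≤ ((Q bad₁ + Q bad₂) + Q bad₃) + Q bad₄ := by
          refine (measure_union_le _ _).trans ?_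
          gcongr
          refine (measure_union_le _ _).trans ?_
          gcongr
          exact measure_union_le _ _
      _ ≤ ((0 + ENNReal.ofReal (2 * e)) + ENNReal.ofReal (2 * e)) + ENNReal.ofReal (c₄ * e) := by
          rw [h₁]; gcongr
      _ = _ := by
          rw [zero_add, ← ENNReal.ofReal_add (by positivity) (by positivity),
            ← ENNReal.ofReal_add (by positivity) (by positivity)]
          congr 1; ring
  -- The true parameter satisfies the radius condition and the derivative bound, so both constants
  -- are nonnegative.
  have hψ0 : 0 ≤ ψ := by
    have := hψ M.θstar M.θstar_mem (by rw [hell_self]; exact hφ.le)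
    simpa using this
  have hτ0 : 0 ≤ τ := by
    obtain ⟨x, hx⟩ := nonempty_obs (M := M)
    exact (abs_nonneg _).trans (hτ M.θstar M.θstar_mem (by simpa using hψ0) x hx)
  have hratio : ∀ y ∈ M.obs, ∀ θ ∈ M.par, θ ∉ U →
      M.ratio p y θ ≤ ENNReal.ofReal (Real.exp (epsTilde p τ ψ / 2)) ∧
      1 ≤ ENNReal.ofReal (Real.exp (epsTilde p τ ψ / 2)) * M.ratio p y θ := by
    intro y hy θ hθ hθU
    have hθψ : ‖θ - M.θstar‖ ≤ ψ := hψ θ hθ (not_lt.1 fun h => hθU ⟨hθ, h⟩)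
    have hsψ : ‖M.θstar - M.θstar‖ ≤ ψ := by simpa using hψ0
    exact ⟨ratio_le_ofReal hp hp1 hy hθ (Real.exp_pos _).le
        (k_le_exp_mul hp hp1 hT hτ0 hτ M.θstar_mem hθ hsψ hθψ hθψ hy),
      one_le_ofReal_mul_ratio hp hp1 hy hθ (Real.exp_pos _).le
        (k_le_exp_mul hp hp1 hT hτ0 hτ hθ M.θstar_mem hθψ hsψ (by rwa [norm_sub_rev]) hy)⟩
  have hU2 : ∀ x, x ∉ bad₃ → x ∉ bad₄ →
      ∫⁻ θ in M.par ∩ U, likRatio (M.ratio p) x θ ∂M.prior ≤ 2 * κ := by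
    intro x hx3 hx4
    have hsub : M.par ∩ U ⊆ (U \ W) ∪ (M.par ∩ W) := by
      intro θ hθ
      by_cases hθW : θ ∈ W
      · exact Or.inr ⟨hθ.1, hθW⟩
      · exact Or.inl ⟨hθ.2, hθW⟩
    calc _ ≤ _ := lintegral_mono_set hsub
      _ ≤ _ := lintegral_union_le _ _ _
      _ ≤ κ + κ := add_le_add (not_le.1 hx3).le (not_le.1 hx4).le
      _ = 2 * κ := (two_mul κ).symm
  refine (measure_privacyFailure_le hP hbad fun x z hx hz hxz S hS hSp => ?_).trans ?_
  · simp only [mem_union, not_or] at hx hz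
    have hxo : ∀ j, x j ∈ M.obs := fun j => by
      by_contra hcon; exact hx.1.1.1 ⟨j, hcon⟩
    have hzo : ∀ j, z j ∈ M.obs := fun j => by
      by_contra hcon; exact hz.1.1.1 ⟨j, hcon⟩
    exact posterior_le_of_ratio_le hp hp1 hxz hxo hzo hU hU (deltaLevel_pos hc₃ n φ) hl0
      (fun θ hθ hθU j => ⟨(hratio _ (hxo j) θ hθ hθU).1, (hratio _ (hzo j) θ hθ hθU).2⟩)
      (fun θ hθ hθU j => ⟨(hratio _ (hzo j) θ hθ hθU).1, (hratio _ (hxo j) θ hθ hθU).2⟩)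
      (hU2 x hx.1.2 hx.2) (hU2 z hz.1.2 hz.2) (not_lt.1 hx.1.1.2)
      (two_mul_exp_le_deltaLevel_mul hc₃) hS hSp
  · rw [mul_assoc 2, ENNReal.ofReal_mul two_pos.le, ENNReal.ofReal_ofNat]

/-! ### A constant `T` uniform in contamination level and radius. -/

open Classical in
variable (M) in
/-- The ratio `f / g`, extended by `0`. -/
noncomputable def fgRatio (x : EuclideanSpace ℝ (Fin m)) (θ : EuclideanSpace ℝ (Fin d)) : ℝ :=
  (M.obs ×ˢ M.par).piecewise (fun z => M.f z.1 z.2 / M.g z.1) 0 (x, θ)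

open Classical in
lemma fgRatio_of_mem {x : EuclideanSpace ℝ (Fin m)} {θ : EuclideanSpace ℝ (Fin d)}
    (hx : x ∈ M.obs) (hθ : θ ∈ M.par) : M.fgRatio x θ = M.f x θ / M.g x :=
  piecewise_eq_of_mem _ _ _ (mk_mem_prod hx hθ)

lemma measurable_fgRatio : Measurable (Function.uncurry M.fgRatio) := by
  classical
  refine (ContinuousOn.div M.continuousOn_f ?_ fun z hz => ?_).measurable_piecewise
    continuousOn_const (M.measurableSet_obs.prod M.measurableSet_par)
  · exact M.continuousOn_g.comp continuousOn_fst fun z hz => hz.1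
  · exact (M.g_pos z.1 hz.1).ne'

variable (M) in
/-- A density that dominates the contaminated likelihoods of all contamination levels. -/
noncomputable def kDom (x : EuclideanSpace ℝ (Fin m)) (θ : EuclideanSpace ℝ (Fin d)) : ℝ≥0∞ :=
  ENNReal.ofReal (M.kExt 0 x θ) + ENNReal.ofReal (M.kExt 1 x θ)

lemma measurable_kDom : Measurable (Function.uncurry M.kDom) :=
  (measurable_kExt.ennreal_ofReal).add measurable_kExt.ennreal_ofReal

open Classical in
lemma ofReal_kExt_le_kDom (hp : 0 ≤ p) (hp1 : p ≤ 1) (x : EuclideanSpace ℝ (Fin m))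
    (θ : EuclideanSpace ℝ (Fin d)) : ENNReal.ofReal (M.kExt p x θ) ≤ M.kDom x θ := by
  unfold kDom
  refine le_trans (ENNReal.ofReal_le_ofReal ?_) ENNReal.ofReal_add_le
  by_cases h : (x, θ) ∈ M.obs ×ˢ M.par
  · simp only [kExt_of_mem h.1 h.2, k]
    have h1 := M.f_nonneg x h.1 θ h.2
    have h2 := (M.g_pos x h.1).le
    nlinarith
  · simp only [kExt, piecewise_eq_of_notMem _ _ _ h, Pi.one_apply]
    norm_num

lemma lintegral_kDom {θ : EuclideanSpace ℝ (Fin d)} (hθ : θ ∈ M.par) :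
    ∫⁻ x in M.obs, M.kDom x θ = 2 := by
  have h : ∀ q : ℝ, 0 ≤ q → q ≤ 1 → ∫⁻ x in M.obs, ENNReal.ofReal (M.kExt q x θ) = 1 := by
    intro q hq hq1
    rw [lintegral_congr_ae (g := fun x => ENNReal.ofReal (M.k q x θ))
      (by filter_upwards [kExt_ae_eq (p := q) hθ] with x hx using by rw [hx]),
      ← ofReal_integral_eq_lintegral_ofReal (integrable_k hθ) (ae_k_nonneg hq hq1 hθ),
      integral_k hθ, ENNReal.ofReal_one]
  unfold kDom
  rw [lintegral_add_left (measurable_kExt_left θ).ennreal_ofReal, h 0 le_rfl zero_le_one,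
    h 1 zero_le_one le_rfl, one_add_one_eq_two]

/-- The ratio `f / g` is rarely large, uniformly in the contamination level. -/
lemma exists_fgRatio_threshold {η : ℝ≥0∞} (hη : η ≠ 0) :
    ∃ V : ℕ, ∀ p : ℝ, 0 < p → p < 1 →
      M.dataLaw p {x | (V : ℝ) < M.fgRatio x M.θstar} ≤ η ∧
      ∫⁻ θ in M.par, ∫⁻ y, {z : EuclideanSpace ℝ (Fin m) × EuclideanSpace ℝ (Fin d) |
        (V : ℝ) < M.fgRatio z.1 z.2}.indicator 1 (y, θ) * M.ratio p y θ ∂M.dataLaw p ∂M.prior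
        ≤ η := by
  have := M.isProbabilityMeasure_prior
  -- Finite measures dominating, for all `p` together, the law of one observation and the joint law
  -- of parameter and observation; a threshold for them is uniform in `p`.
  let ν₁ := (volume.restrict M.obs).withDensity fun x => M.kDom x M.θstar
  let ν₂ := ((volume.restrict M.obs).prod (M.prior.restrict M.par)).withDensity
    (Function.uncurry M.kDom)
  have hν₁ : IsFiniteMeasure ν₁ := isFiniteMeasure_withDensity (by
    rw [lintegral_kDom M.θstar_mem]; simp)
  have hν₂ : IsFiniteMeasure ν₂ := isFiniteMeasure_withDensity (by
    rw [lintegral_prod_symm _ measurable_kDom.aemeasurable]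
    have h : ∫⁻ θ in M.par, (∫⁻ x in M.obs, Function.uncurry M.kDom (x, θ)) ∂M.prior
        = ∫⁻ _ in M.par, 2 ∂M.prior :=
      setLIntegral_congr_fun M.measurableSet_par fun θ hθ => lintegral_kDom hθ
    rw [h]
    simp [ENNReal.mul_eq_top])
  have hR₁ : Measurable fun x => M.fgRatio x M.θstar := measurable_fgRatio.of_uncurry_right
  obtain ⟨V₁, hV₁⟩ := exists_nat_measure_gt_le ν₁ hR₁ hη
  obtain ⟨V₂, hV₂⟩ := exists_nat_measure_gt_le ν₂ (measurable_fgRatio (M := M)) hη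
  refine ⟨max V₁ V₂, fun p hp hp1 => ⟨?_, ?_⟩⟩
  · refine le_trans ?_ (hV₁ (max V₁ V₂) (le_max_left _ _))
    have hm := measurableSet_lt (measurable_const (a := ((max V₁ V₂ : ℕ) : ℝ))) hR₁
    rw [dataLaw_eq, withDensity_apply _ hm, withDensity_apply _ hm]
    exact lintegral_mono fun x => ofReal_kExt_le_kDom hp.le hp1.le x _
  · refine le_trans ?_ (hV₂ (max V₁ V₂) (le_max_right _ _))
    set D : Set (EuclideanSpace ℝ (Fin m) × EuclideanSpace ℝ (Fin d)) :=
      {z | ((max V₁ V₂ : ℕ) : ℝ) < M.fgRatio z.1 z.2} with hD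
    have hm : MeasurableSet D := measurableSet_lt measurable_const measurable_fgRatio
    have hI : Measurable (D.indicator (1 : EuclideanSpace ℝ (Fin m) × EuclideanSpace ℝ (Fin d) →
        ℝ≥0∞)) := measurable_one.indicator hm
    change _ ≤ ν₂ D
    rw [withDensity_apply _ hm, ← lintegral_indicator hm,
      lintegral_prod_symm _ (measurable_kDom.indicator hm).aemeasurable]
    refine lintegral_mono fun θ => ?_
    have hIθ : Measurable fun y => D.indicator (1 : EuclideanSpace ℝ (Fin m) ×
        EuclideanSpace ℝ (Fin d) → ℝ≥0∞) (y, θ) :=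
      hI.comp measurable_prodMk_right
    calc ∫⁻ y, D.indicator 1 (y, θ) * M.ratio p y θ ∂M.dataLaw p
        = ∫⁻ y, M.ratio p y θ * D.indicator 1 (y, θ) ∂M.dataLaw p := by simp only [mul_comm]
      _ = ∫⁻ y in M.obs, ENNReal.ofReal (M.kExt p y θ) * D.indicator 1 (y, θ) :=
          lintegral_ratio_mul hp hp1 θ hIθ
      _ ≤ ∫⁻ y in M.obs, D.indicator (Function.uncurry M.kDom) (y, θ) := by
          refine lintegral_mono fun y => ?_
          by_cases h : (y, θ) ∈ D
          · simpa [h] using ofReal_kExt_le_kDom hp.le hp1.le y θ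
          · simp [h]

/-- A constant `T` that works for all contamination levels and radii. -/
lemma exists_measure_privacyFailure_le {θ₁ : EuclideanSpace ℝ (Fin d)} (hθ₁ : θ₁ ∈ M.par)
    (hne : θ₁ ≠ M.θstar) {p₀ : ℝ} (hp₀ : p₀ < 1) {n : ℕ} (hn : 1 ≤ n) {φ α c₃ : ℝ} (hφ : 0 < φ)
    (hα : 0 < α) (hc₃ : 0 < c₃)
    (hcentre : ENNReal.ofReal (c₃ * Real.exp (-(2 * n * (1 / 32 * φ ^ 2 / 8))))
      ≤ M.prior (M.rhoBall 0 α (1 / 32 * φ ^ 2 / 8))) :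
    ∃ T : ℝ, 0 < T ∧ ∀ p ψ : ℝ, 0 < p → p ≤ p₀ → M.RadiusBound p φ ψ →
      ∀ P : Measure ((Fin n → EuclideanSpace ℝ (Fin m)) × (Fin n → EuclideanSpace ℝ (Fin m))),
      M.IsNeighbourLaw p n P →
      P (M.privacyFailure p n (epsLevel (deltaLevel (1 / 32) c₃ n φ) p T ψ)
        (deltaLevel (1 / 32) c₃ n φ))
      ≤ ENNReal.ofReal (2 * 4 * Real.exp (-(n * min (1 / 32 * α / 8) (1 / 32) * φ ^ 2))) := by
  have := M.isProbabilityMeasure_prior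
  have hn0 : (0 : ℝ) < n := by exact_mod_cast hn
  set ρ : ℝ := Real.exp (-(n * (φ ^ 2 / 32))) with hρ
  have hρ0 : 0 < ρ := Real.exp_pos _
  have hρ1 : ρ ≤ 1 := Real.exp_le_one_iff.2 (by rw [neg_nonpos]; positivity)
  set e : ℝ := Real.exp (-(n * min (1 / 32 * α / 8) (1 / 32) * φ ^ 2)) with he
  have he0 : 0 < e := Real.exp_pos _
  have hρe : ρ ≤ e := exp_rate_le
  -- The factor `1/n` pays for the union over observations, and one of the two factors `ρ` for the
  -- division by `κ = 2ρ`.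
  obtain ⟨V, hV⟩ := exists_fgRatio_threshold (M := M) (η := ENNReal.ofReal (ρ ^ 2 / n)) (by
    simp only [ne_eq, ENNReal.ofReal_eq_zero, not_le]; positivity)
  obtain ⟨θ₂, hθ₂, hne₂, hhell⟩ := exists_ne_hell_le hθ₁ hne hφ
  have hs : 0 < ‖θ₂ - M.θstar‖ := norm_pos_iff.2 (sub_ne_zero.2 hne₂)
  set s := ‖θ₂ - M.θstar‖
  have hp₀' : 0 < 1 - p₀ := by linarith
  -- Contamination shrinks Hellinger distance, so `θ₂` lies in the ball for every `p` and forces `ψ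
  -- ≥ s`. Then `(1 - p) T ψ ≥ V + 1`, and `exp(ε̃/2) ≥ (V + 1)/p`.
  refine ⟨(V + 1) / ((1 - p₀) * s), by positivity, ?_⟩
  intro p ψ hp hpp hψ P hP
  have hp1 : p < 1 := hpp.trans_lt hp₀
  have := isProbabilityMeasure_dataLaw (M := M) hp hp1
  set T : ℝ := (V + 1) / ((1 - p₀) * s) with hT
  have hT0 : 0 < T := by positivity
  have hsψ : s ≤ ψ := hψ θ₂ hθ₂ ((hell_le_hell_zero hp.le hp1.le hθ₂ M.θstar_mem).trans hhell)
  have hlarge : ((V : ℝ) + 1) / p ≤ Real.exp (epsTilde p T ψ / 2) := by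
    have h1 : epsTilde p T ψ / 2 = (1 - p) * T * ψ / p := by unfold epsTilde; ring
    have h2 : (V : ℝ) + 1 ≤ (1 - p) * T * ψ := by
      calc (V : ℝ) + 1 = (1 - p₀) * T * s := by rw [hT]; field_simp
        _ ≤ (1 - p) * T * ψ := by gcongr
    calc ((V : ℝ) + 1) / p ≤ epsTilde p T ψ / 2 := by rw [h1]; gcongr
      _ ≤ _ := by linarith [Real.add_one_le_exp (epsTilde p T ψ / 2)]
  set Q := Measure.pi fun _ : Fin n => M.dataLaw p
  set κ : ℝ≥0∞ := 2 * ENNReal.ofReal ρ with hκ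
  have hκ0 : κ ≠ 0 := by simp [hκ, hρ0]
  have hκt : κ ≠ ∞ := ENNReal.mul_ne_top (by simp) ENNReal.ofReal_ne_top
  set l : ℝ≥0∞ := ENNReal.ofReal (c₃ / 2 * Real.exp (-(4 * n * (1 / 32 * φ ^ 2 / 8)))) with hl
  have hl0 : l ≠ 0 := by
    rw [hl]; simp only [ne_eq, ENNReal.ofReal_eq_zero, not_le]; positivity
  set D : Set (EuclideanSpace ℝ (Fin m) × EuclideanSpace ℝ (Fin d)) :=
    {z | (V : ℝ) < M.fgRatio z.1 z.2} with hD
  have hDm : MeasurableSet D := measurableSet_lt measurable_const measurable_fgRatio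
  -- Unlike the Hellinger-far set, this exceptional set depends on the dataset, so the two datasets
  -- of a pair get different ones.
  let U : (Fin n → EuclideanSpace ℝ (Fin m)) → Set (EuclideanSpace ℝ (Fin d)) := fun x =>
    {θ | ∃ j, (x j, θ) ∈ D}
  have hU : ∀ x, MeasurableSet (U x) := fun x => by
    simp only [U]
    rw [ofPred_exists]
    exact MeasurableSet.iUnion fun j => hDm.preimage measurable_prodMk_left
  let bad₁ : Set (Fin n → EuclideanSpace ℝ (Fin m)) := {x | ∃ j, x j ∈ M.obsᶜ}
  let bad₂ : Set (Fin n → EuclideanSpace ℝ (Fin m)) :=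
    {x | ∫⁻ θ in M.par, likRatio (M.ratio p) x θ ∂M.prior < l}
  let bad₃ : Set (Fin n → EuclideanSpace ℝ (Fin m)) :=
    {x | ∃ j, x j ∈ {y | (V : ℝ) < M.fgRatio y M.θstar}}
  let bad₄ : Set (Fin n → EuclideanSpace ℝ (Fin m)) :=
    {x | κ ≤ ∫⁻ θ in M.par ∩ U x, likRatio (M.ratio p) x θ ∂M.prior}
  have hnη : (n : ℝ≥0∞) * ENNReal.ofReal (ρ ^ 2 / n) = ENNReal.ofReal (ρ ^ 2) := by
    rw [← ENNReal.ofReal_natCast, ← ENNReal.ofReal_mul hn0.le]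
    congr 1; field_simp
  have h₁ : Q bad₁ = 0 := measure_pi_exists_notMem_obs hp hp1 n
  have h₂ : Q bad₂ ≤ ENNReal.ofReal (2 * e) := by
    refine (measure_lintegral_par_lt_le hp hp1 hα hc₃ (by positivity) hcentre).trans ?_
    rw [ENNReal.ofReal_mul two_pos.le, ENNReal.ofReal_ofNat]
    gcongr
    exact exp_rate_le'
  have h₃ : Q bad₃ ≤ ENNReal.ofReal e := by
    have hR₁ : Measurable fun x => M.fgRatio x M.θstar := measurable_fgRatio.of_uncurry_right
    refine (measure_pi_exists_mem_le _ (measurableSet_lt measurable_const hR₁)).trans ?_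
    calc _ ≤ (n : ℝ≥0∞) * ENNReal.ofReal (ρ ^ 2 / n) := by gcongr; exact (hV p hp hp1).1
      _ = ENNReal.ofReal (ρ ^ 2) := hnη
      _ ≤ _ := ENNReal.ofReal_le_ofReal (by nlinarith)
  have h₄ : Q bad₄ ≤ ENNReal.ofReal e := by
    refine (measure_le_setLIntegral_likRatio_le_of_exists (M.dataLaw p) M.prior measurable_ratio
      M.measurableSet_par (fun θ hθ => (lintegral_ratio hp hp1 hθ).le) hDm hκ0 hκt).trans ?_
    refine (ENNReal.div_le_iff hκ0 hκt).2 ?_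
    calc _ ≤ (n : ℝ≥0∞) * ENNReal.ofReal (ρ ^ 2 / n) := by gcongr; exact (hV p hp hp1).2
      _ = ENNReal.ofReal (ρ * ρ) := by rw [hnη, sq]
      _ = ENNReal.ofReal ρ * (1 * ENNReal.ofReal ρ) := by rw [ENNReal.ofReal_mul hρ0.le, one_mul]
      _ ≤ ENNReal.ofReal e * (2 * ENNReal.ofReal ρ) := by
          gcongr
          exact one_le_two
  have hbad : Q (((bad₁ ∪ bad₂) ∪ bad₃) ∪ bad₄) ≤ ENNReal.ofReal (4 * e) := by
    calc _ ≤ ((Q bad₁ + Q bad₂) + Q bad₃) + Q bad₄ := by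
          refine (measure_union_le _ _).trans ?_
          gcongr
          refine (measure_union_le _ _).trans ?_
          gcongr
          exact measure_union_le _ _
      _ ≤ ((0 + ENNReal.ofReal (2 * e)) + ENNReal.ofReal e) + ENNReal.ofReal e := by
          rw [h₁]; gcongr
      _ = _ := by
          rw [zero_add, ← ENNReal.ofReal_add (by positivity) (by positivity),
            ← ENNReal.ofReal_add (by positivity) (by positivity)]
          congr 1; ring
  -- The parameters need not be close: `k_p(y;θ) ≤ (V + 1) g` while `k_p(y;θ') ≥ p g`.
  have hk : ∀ y ∈ M.obs, ∀ θ ∈ M.par, ∀ θ' ∈ M.par, ¬ (V : ℝ) < M.fgRatio y θ →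
      M.k p y θ ≤ Real.exp (epsTilde p T ψ / 2) * M.k p y θ' := by
    intro y hy θ hθ θ' hθ' h
    have hg := M.g_pos y hy
    rw [fgRatio_of_mem hy hθ, not_lt, div_le_iff₀ hg] at h
    have hf' := M.f_nonneg y hy θ' hθ'
    have h1 : M.k p y θ ≤ (V + 1) * M.g y := by
      have hf := M.f_nonneg y hy θ hθ
      unfold k; nlinarith
    have h2 : p * M.g y ≤ M.k p y θ' := by
      have := mul_nonneg (by linarith : 0 ≤ 1 - p) hf'
      unfold k; linarith
    calc M.k p y θ ≤ (V + 1) / p * (p * M.g y) := by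
          refine h1.trans (le_of_eq ?_); field_simp
      _ ≤ _ := by gcongr
  refine (measure_privacyFailure_le hP hbad fun x z hx hz hxz S hS hSp => ?_).trans ?_
  · simp only [mem_union, not_or] at hx hz
    have good : ∀ w : Fin n → EuclideanSpace ℝ (Fin m), w ∉ bad₁ → w ∉ bad₃ →
        (∀ j, w j ∈ M.obs) ∧
        (∀ θ ∈ M.par, θ ∉ U w → ∀ j,
          M.ratio p (w j) θ ≤ ENNReal.ofReal (Real.exp (epsTilde p T ψ / 2))) ∧
        ∀ θ ∈ M.par, ∀ j,
          1 ≤ ENNReal.ofReal (Real.exp (epsTilde p T ψ / 2)) * M.ratio p (w j) θ := by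
      intro w hw1 hw3
      have hwo : ∀ j, w j ∈ M.obs := fun j => by
        by_contra hcon; exact hw1 ⟨j, hcon⟩
      refine ⟨hwo, fun θ hθ hθU j => ?_, fun θ hθ j => ?_⟩
      · exact ratio_le_ofReal hp hp1 (hwo j) hθ (Real.exp_pos _).le
          (hk _ (hwo j) θ hθ _ M.θstar_mem fun h => hθU ⟨j, h⟩)
      · exact one_le_ofReal_mul_ratio hp hp1 (hwo j) hθ (Real.exp_pos _).le
          (hk _ (hwo j) _ M.θstar_mem θ hθ fun h => hw3 ⟨j, h⟩)
    obtain ⟨hxo, hx1, hx2⟩ := good x hx.1.1.1 hx.1.2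
    obtain ⟨hzo, hz1, hz2⟩ := good z hz.1.1.1 hz.1.2
    exact posterior_le_of_ratio_le hp hp1 hxz hxo hzo (hU x) (hU z) (deltaLevel_pos hc₃ n φ) hl0
      (fun θ hθ hθU j => ⟨hx1 θ hθ hθU j, hz2 θ hθ j⟩)
      (fun θ hθ hθU j => ⟨hz1 θ hθ hθU j, hx2 θ hθ j⟩)
      (not_le.1 hx.2).le (not_le.1 hz.2).le (not_lt.1 hx.1.1.2)
      (two_mul_exp_le_deltaLevel_mul hc₃) hS hSp
  · rw [mul_assoc 2, ENNReal.ofReal_mul two_pos.le, ENNReal.ofReal_ofNat]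

/-- For a one-point parameter space there are no feasible directions. -/
lemma derivRatioBound_of_subsingleton (h : ∀ θ ∈ M.par, θ = M.θstar) (ψ : ℝ) {τ : ℝ}
    (hτ : 0 ≤ τ) : M.DerivRatioBound ψ τ := by
  intro θ hθ _ x _
  have he : feasibleDirections M.par θ = ∅ := by
    refine eq_empty_of_forall_notMem ?_
    rintro u ⟨hu, ξ, hξ, hmem⟩
    have h1 := (h _ hmem).trans (h θ hθ).symm
    rw [add_eq_left, smul_eq_zero] at h1
    rcases h1 with h1 | h1
    · exact hξ.ne' h1
    · rw [h1, norm_zero] at hu; exact zero_ne_one hu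
  -- The supremum over the empty set is zero.
  simpa [supDirDeriv, he] using hτ

end ContaminationModel

/-! ### Assembling the theorem. -/

/-- One exponential bound covers both regimes; the logarithmic term only adds slack, so its
coefficient can be one. -/
lemma le_failureBound {c₁ c₂ α C : ℝ} (n : ℕ) (φ : ℝ) :
    C * Real.exp (-(n * min (c₁ * α / 8) c₂ * φ ^ 2)) ≤ failureBound c₁ c₂ α C C 1 n φ := by
  unfold failureBound
  split_ifs
  · exact le_rfl
  · gcongr
    nlinarith [sq_nonneg (Real.log φ)]

lemma tendsto_failureBound {c₁ c₂ α C₁ C₂ C₃ : ℝ} (hc₁ : 0 < c₁) (hc₂ : 0 < c₂) (hα : 0 < α)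
    {φ : ℕ → ℝ} (hφ : Tendsto (fun n : ℕ => (n : ℝ) * φ n ^ 2) atTop atTop) :
    Tendsto (fun n => failureBound c₁ c₂ α C₁ C₂ C₃ n (φ n)) atTop (𝓝 0) := by
  have hc : 0 < min (c₁ * α / 8) c₂ := lt_min (by positivity) hc₂
  have h1 : Tendsto (fun n : ℕ => C₁ * Real.exp (-(min (c₁ * α / 8) c₂ * (n * φ n ^ 2)))) atTop
      (𝓝 0) := by
    have := (Real.tendsto_exp_neg_atTop_nhds_zero.comp (hφ.const_mul_atTop hc)).const_mul C₁
    simpa using this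
  refine h1.congr' ?_
  filter_upwards [(hφ.const_mul_atTop hc₂).eventually_ge_atTop (Real.log 2)] with n hn
  rw [failureBound, if_pos (by linarith)]
  ring_nf

theorem mainTheorem1 :
    -- universal constants of the entropy bound, which enter the assumptions
    ∃ c c₁ c₂ : ℝ, 0 < c ∧ 0 < c₁ ∧ 0 < c₂ ∧
    ∀ (m d : ℕ) (M : ContaminationModel m d) (φ : ℕ → ℝ)
      (Om : ℕ → Set (EuclideanSpace ℝ (Fin d))) (α c₃ c₄ : ℝ),
      0 < α → α ≤ 1 → 0 < c₃ → 0 < c₄ →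
      AntitoneOn φ (Set.Ici 1) →
      M.EntropyAssumption c φ Om →
      M.PriorCentreAssumption c₁ c₂ α c₃ φ →
      M.PriorTailAssumption c₁ c₄ φ Om →
      M.TailAssumption →
      M.IdentifiabilityAssumption →
    ∀ p₀ : ℝ, 0 < p₀ → p₀ < 1 →
    ∃ (T : ℕ → ℝ) (C₁ C₂ C₃ : ℝ), (∀ n, 0 < T n) ∧ 0 < C₁ ∧ 0 < C₂ ∧ 0 < C₃ ∧
    ∀ p : ℕ → ℝ, (∀ n, 1 ≤ n → 0 < p n ∧ p n ≤ p₀) → AntitoneOn p (Set.Ici 1) →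
      Tendsto p atTop (𝓝 0) →
      -- the radii `ψ n` exist and tend to zero
      (∃ ψ : ℕ → ℝ, Tendsto ψ atTop (𝓝 0) ∧ ∀ᶠ n in atTop, M.RadiusBound (p n) (φ n) (ψ n)) ∧
      -- the bounds hold with any admissible radii, with `T n`, and with any bound on `|∇̃f / g|`
      -- over the Euclidean ball of radius `ψ n` in place of `T n`
      ∀ (ψ τ : ℕ → ℝ)
        (P : ∀ n : ℕ, Measure
          ((Fin n → EuclideanSpace ℝ (Fin m)) × (Fin n → EuclideanSpace ℝ (Fin m)))),
        (∀ n, 1 ≤ n → M.IsNeighbourLaw (p n) n (P n)) →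
        (∀ n, 1 ≤ n → M.RadiusBound (p n) (φ n) (ψ n) →
          (τ n = T n ∨ M.DerivRatioBound (ψ n) (τ n)) →
          P n (M.privacyFailure (p n) n
              (epsLevel (deltaLevel c₁ c₃ n (φ n)) (p n) (τ n) (ψ n))
              (deltaLevel c₁ c₃ n (φ n)))
            ≤ ENNReal.ofReal (failureBound c₁ c₂ α C₁ C₂ C₃ n (φ n))) ∧
        ((∀ᶠ n in atTop, M.RadiusBound (p n) (φ n) (ψ n) ∧
            (τ n = T n ∨ M.DerivRatioBound (ψ n) (τ n))) →
          Tendsto (fun n => P n (M.privacyFailure (p n) n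
              (epsLevel (deltaLevel c₁ c₃ n (φ n)) (p n) (τ n) (ψ n))
              (deltaLevel c₁ c₃ n (φ n)))) atTop (𝓝 0)) := by
  -- The rate `1/32` is what remains of the test exponent `1/16` after paying for the net; `1/100`
  -- keeps the net below `exp(n φ²/32)` points.
  refine ⟨1 / 100, 1 / 32, 1 / 32, by norm_num, by norm_num, by norm_num, ?_⟩
  intro m d M φ Om α c₃ c₄ hα _ hc₃ hc₄ _ hE hC hTl hT hid p₀ _ hp₀
  obtain ⟨hφ, hφ0, hφn, _, _, hent⟩ := hE
  have hC0 : 0 < 2 * (4 + c₄) := by positivity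
  have hτbound : ∀ (n : ℕ), 1 ≤ n → ∀ p ψ τ : ℝ, 0 < p → p ≤ p₀ → M.RadiusBound p (φ n) ψ →
      M.DerivRatioBound ψ τ → ∀ P, M.IsNeighbourLaw p n P →
      P (M.privacyFailure p n (epsLevel (deltaLevel (1 / 32) c₃ n (φ n)) p τ ψ)
        (deltaLevel (1 / 32) c₃ n (φ n))) ≤ ENNReal.ofReal (2 * (4 + c₄) *
          Real.exp (-(n * min (1 / 32 * α / 8) (1 / 32) * φ n ^ 2))) :=
    fun n hn p ψ τ hp hpp hψ hτ P hP =>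
      M.measure_privacyFailure_le_of_derivRatioBound hp (hpp.trans_lt hp₀) (hφ n hn) hα hc₃ hc₄
        (hent n hn) (hC n hn).1 (hTl n hn) hT hψ hτ hP
  have hTex : ∀ n : ℕ, ∃ T : ℝ, 0 < T ∧ (1 ≤ n → ∀ p ψ : ℝ, 0 < p → p ≤ p₀ →
      M.RadiusBound p (φ n) ψ → ∀ P, M.IsNeighbourLaw p n P →
      P (M.privacyFailure p n (epsLevel (deltaLevel (1 / 32) c₃ n (φ n)) p T ψ)
        (deltaLevel (1 / 32) c₃ n (φ n))) ≤ ENNReal.ofReal (2 * (4 + c₄) *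
          Real.exp (-(n * min (1 / 32 * α / 8) (1 / 32) * φ n ^ 2)))) := by
    intro n
    by_cases hn : 1 ≤ n
    -- With a single parameter the radius may be zero, so a large `T` gains nothing; but any
    -- nonnegative `τ` is then a derivative bound.
    · by_cases hpar : ∀ θ ∈ M.par, θ = M.θstar
      · exact ⟨1, one_pos, fun _ p ψ hp hpp hψ P hP => hτbound n hn p ψ 1 hp hpp hψ
          (M.derivRatioBound_of_subsingleton hpar ψ zero_le_one) P hP⟩
      · push Not at hpar
        obtain ⟨θ₁, hθ₁, hne⟩ := hpar
        obtain ⟨T, hT0, hTb⟩ := M.exists_measure_privacyFailure_le hθ₁ hne hp₀ hn (hφ n hn) hα hc₃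
          (hC n hn).1
        refine ⟨T, hT0, fun _ p ψ hp hpp hψ P hP => (hTb p ψ hp hpp hψ P hP).trans ?_⟩
        refine ENNReal.ofReal_le_ofReal ?_
        gcongr
        linarith
    · exact ⟨1, one_pos, fun h => absurd h hn⟩
  choose T hT0 hTb using hTex
  refine ⟨T, 2 * (4 + c₄), 2 * (4 + c₄), 1, hT0, hC0, hC0, one_pos, ?_⟩
  intro p hp _ _
  refine ⟨M.exists_tendsto_radiusBound hid hφ hφ0 hp₀ hp, ?_⟩
  intro ψ τ P hP
  have hmain : ∀ n, 1 ≤ n → M.RadiusBound (p n) (φ n) (ψ n) →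
      (τ n = T n ∨ M.DerivRatioBound (ψ n) (τ n)) →
      P n (M.privacyFailure (p n) n
          (epsLevel (deltaLevel (1 / 32) c₃ n (φ n)) (p n) (τ n) (ψ n))
          (deltaLevel (1 / 32) c₃ n (φ n)))
        ≤ ENNReal.ofReal (failureBound (1 / 32) (1 / 32) α (2 * (4 + c₄)) (2 * (4 + c₄)) 1 n
          (φ n)) := by
    intro n hn hψ hτ
    refine le_trans ?_ (ENNReal.ofReal_le_ofReal (le_failureBound n (φ n)))
    rcases hτ with hτ | hτ
    · rw [hτ]
      exact hTb n hn (p n) (ψ n) (hp n hn).1 (hp n hn).2 hψ (P n) (hP n hn)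
    · exact hτbound n hn (p n) (ψ n) (τ n) (hp n hn).1 (hp n hn).2 hψ hτ (P n) (hP n hn)
  refine ⟨hmain, fun hev => ?_⟩
  have hlim : Tendsto (fun n => ENNReal.ofReal (failureBound (1 / 32) (1 / 32) α (2 * (4 + c₄))
      (2 * (4 + c₄)) 1 n (φ n))) atTop (𝓝 0) := by
    simpa using ENNReal.tendsto_ofReal (tendsto_failureBound (by norm_num) (by norm_num) hα hφn)
  refine tendsto_of_tendsto_of_tendsto_of_le_of_le' tendsto_const_nhds hlim
    (Eventually.of_forall fun _ => zero_le) ?_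
  filter_upwards [hev, eventually_ge_atTop 1] with n hn hn1 using hmain n hn1 hn.1 hn.2
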